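/- **Theorem (Twin codes).** Let $W:\{0,1\}\to\mathcal Y$ be a binary memoryless symmetric channel with finite output alphabet $\mathcal Y$, i.e. there is a permutation $\pi=\pi^{-1}$ of $\mathcal Y$ with $W(y|1)=W(\pi(y)|0)$ for all $y$, and let $I(W)$ be its capacity (in bits). For $m\ge 0$ put $n=2^m$, and for $A\subseteq[m]$ let $v_m(A)\in\mathbb F_2^{\{0,1\}^m}$ be the row $v_m(A,z)=\prod_{i\in A}z_i$. Order the subsets of $[m]$ by $A<B$ iff $|A|>|B|$, or $|A|=|B|$ and the list of elements of $A$ in decreasing order is lexicographically smaller than that of $B$. Let $(U_A)_{A\subseteq[m]}$ be i.i.d. Bernoulli-$1/2$, let $Y=(Y_z)_{z\in\{0,1\}^m}$ be the output when $\sum_{A}U_A v_m(A)\in\mathbb F_2^{\{0,1\}^m}$ is sent over $n$ independent copies of $W$, let $U_{<A}=(U_B)_{B<A}$, and let $$Z_A^{(m)}=Z(U_A\mid Y,U_{<A}),\qquad Z(X\mid V)=\sum_{v}\sqrt{P_{V|X}(v|0)\,P_{V|X}(v|1)} .$$ Let $(\delta_n)$ be a sequence of real numbers that is polynomial in $1/n$,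 in the sense that $\delta_n\ge n^{-d}$ for some constant $d$ and all large $n$, and such that $\delta_n=o(n^{-2})$. Let $\mathcal G(m,\delta_n)=\{A\subseteq[m]:Z_A^{(m)}<\delta_n\}$ and let $$\mathcal T(m,\delta_n)=\Big\{\sum_{A\in\mathcal G(m,\delta_n)}u(A)\,v_m(A):u(A)\in\{0,1\}\Big\}$$ be the twin code. Then $\mathcal T(m,\delta_n)$ achieves the capacity of $W$ under successive decoding, that is, as $m\to\infty$: 1. the rate $\frac1n\log_2|\mathcal T(m,\delta_n)|$ tends to $I(W)$; 2. for a uniformly distributed message $(u(A))_{A\in\mathcal G(m,\delta_n)}$, the block error probability of the successive decoder tends to $0$. This decoder processes the sets $A\subseteq[m]$ in increasing order; it sets $\hat u_A=0$ if $A\notin\mathcal G(m,\delta_n)$, and otherwise takes for $\hat u_A$ a value $a\in\{0,1\}$ that maximizes $P(U_A=a,\,Y=y,\,U_{<A}=\hat u_{<A})$, where $y$ is the received word. The claim holds for every (deterministic) rule for breaking ties. -/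

import Mathlib

open Finset Filter Topology Asymptotics

namespace TwinCode

noncomputable section

/-! ### Channels and capacity -/

/-- A binary memoryless symmetric channel with input alphabet `{0,1}` and finite output alphabet
`𝒴`; `prob x y` is the transition probability `W(y | x)`. -/
structure BMSChannel (𝒴 : Type*) [Fintype 𝒴] where
  prob : ZMod 2 → 𝒴 → ℝ
  nonneg : ∀ x y, 0 ≤ prob x y
  sum_eq_one : ∀ x, ∑ y, prob x y = 1
  symmetric : ∃ π : Equiv.Perm 𝒴, π⁻¹ = π ∧ ∀ y, prob 1 y = prob 0 (π y)

/-- The input distribution on `{0,1}` that gives mass `p` to `1` and mass `1 - p` to `0`. -/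
def inputDist (p : ℝ) (x : ZMod 2) : ℝ := if x = 1 then p else 1 - p

/-- Mutual information, in bits, between the input and the output of `W` for the input
distribution `inputDist p`:
`∑ P(x) W(y|x) log₂ (W(y|x) / P_Y(y))`, with terms of zero mass contributing `0`. -/
def mutualInfo {𝒴 : Type*} [Fintype 𝒴] (W : BMSChannel 𝒴) (p : ℝ) : ℝ :=
  ∑ x, ∑ y, inputDist p x * W.prob x y *
    Real.logb 2 (W.prob x y / ∑ x', inputDist p x' * W.prob x' y)

/-- The capacity `I(W)`, in bits per channel use: the supremum of the mutual information over all
input distributions. -/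
def capacity {𝒴 : Type*} [Fintype 𝒴] (W : BMSChannel 𝒴) : ℝ :=
  sSup (mutualInfo W '' Set.Icc 0 1)

/-! ### Rows and their order -/

/-- The index set `{0,1}^m` of the coordinates of a word of length `n = 2^m`. -/
abbrev Cube (m : ℕ) : Type := Fin m → ZMod 2

/-- The row `v_m(A)`: the evaluation vector of the monomial `∏_{i ∈ A} Z_i`. -/
def row {m : ℕ} (A : Finset (Fin m)) : Cube m → ZMod 2 := fun z => ∏ i ∈ A, z i

/-- The word `∑_A u(A) v_m(A)`. -/
def encode {m : ℕ} (u : Finset (Fin m) → ZMod 2) : Cube m → ZMod 2 := ∑ A, u A • row A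

/-- The strict total order in which rows are processed: larger sets come first, and sets of the
same size, listed in decreasing order of their elements, are compared lexicographically.  At equal
size this is the colexicographic order: the first place where the two decreasing lists differ
holds the largest element of the symmetric difference, and that element belongs to the larger
set. -/
def RMLT {m : ℕ} (A B : Finset (Fin m)) : Prop :=
  B.card < A.card ∨ (A.card = B.card ∧ toColex A < toColex B)

instance {m : ℕ} : DecidableRel (RMLT (m := m)) := fun A B => by
  unfold RMLT; infer_instance

theorem rmlt_wellFounded (m : ℕ) : WellFounded (RMLT (m := m)) := by
  have : Std.Irrefl (RMLT (m := m)) := ⟨fun A h => by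
    rcases h with h | h
    · exact lt_irrefl _ h
    · exact lt_irrefl _ h.2⟩
  have : IsTrans (Finset (Fin m)) RMLT := ⟨fun A B C h h' => by
    rcases h with h | ⟨h, h₁⟩ <;> rcases h' with h' | ⟨h', h₂⟩
    · exact Or.inl (by omega)
    · exact Or.inl (by omega)
    · exact Or.inl (by omega)
    · exact Or.inr ⟨by omega, h₁.trans h₂⟩⟩
  exact Finite.wellFounded_of_trans_of_irrefl _

/-! ### The random variables `U^{(m)}`, `Y^{(m)}` and the Bhattacharyya parameters -/

open scoped Classical in
/-- Probability of the event `E` under the probability mass function `P`. -/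
def Pr {Ω : Type*} [Fintype Ω] (P : Ω → ℝ) (E : Ω → Prop) : ℝ := ∑ ω with E ω, P ω

/-- The Bhattacharyya parameter `Z(X|Y) = ∑_y √(P_{Y|X}(y|0) P_{Y|X}(y|1))`. -/
def bhattacharyya {Ω β : Type*} [Fintype Ω] [Fintype β] (P : Ω → ℝ)
    (X : Ω → ZMod 2) (Y : Ω → β) : ℝ :=
  ∑ y, √((Pr P (fun ω => X ω = 0 ∧ Y ω = y) / Pr P (fun ω => X ω = 0)) *
    (Pr P (fun ω => X ω = 1 ∧ Y ω = y) / Pr P (fun ω => X ω = 1)))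

/-- Probability that `2^m` independent uses of `W` output `y` when the word `x` is sent. -/
def wordProb {𝒴 : Type*} [Fintype 𝒴] (W : BMSChannel 𝒴) {m : ℕ}
    (x : Cube m → ZMod 2) (y : Cube m → 𝒴) : ℝ := ∏ z, W.prob (x z) (y z)

section

-- decidability of equality on the cube only serves to enumerate finite function spaces
open scoped Classical

/-- Joint law of `(U^{(m)}, Y^{(m)})`: the `2^m` bits `U_A` are i.i.d. uniform, and the word
`∑_A U_A v_m(A)` is sent over `2^m` independent copies of `W`. -/
def jointLaw {𝒴 : Type*} [Fintype 𝒴] (W : BMSChannel 𝒴) (m : ℕ) :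
    (Finset (Fin m) → ZMod 2) × (Cube m → 𝒴) → ℝ :=
  fun ω => (1 / 2) ^ (2 ^ m) * wordProb W (encode ω.1) ω.2

/-- The restriction `u_{<A}` of `u` to the indices preceding `A`. -/
def past {m : ℕ} (A : Finset (Fin m)) (u : Finset (Fin m) → ZMod 2) :
    {B : Finset (Fin m) // RMLT B A} → ZMod 2 := fun B => u B.1

/-- `Z_A^{(m)} = Z(U_A | Y^{(m)}, U_{<A})`. -/
def Zparam {𝒴 : Type*} [Fintype 𝒴] (W : BMSChannel 𝒴) {m : ℕ} (A : Finset (Fin m)) : ℝ :=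
  bhattacharyya (jointLaw W m) (fun ω => ω.1 A) (fun ω => (ω.2, past A ω.1))

/-! ### Twin codes -/

/-- `𝒢(m, δ) = {A ⊆ [m] : Z_A^{(m)} < δ}`. -/
def goodSets {𝒴 : Type*} [Fintype 𝒴] (W : BMSChannel 𝒴) (m : ℕ) (δ : ℝ) :
    Finset (Finset (Fin m)) := {A | Zparam W A < δ}

/-- The twin code `𝒯(m, δ)`: all sums `∑_{A ∈ 𝒢(m, δ)} u(A) v_m(A)`. -/
def twinCode {𝒴 : Type*} [Fintype 𝒴] (W : BMSChannel 𝒴) (m : ℕ) (δ : ℝ) :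
    Set (Cube m → ZMod 2) :=
  {c | ∃ u : Finset (Fin m) → ZMod 2, c = ∑ A ∈ goodSets W m δ, u A • row A}

/-- The rate `log₂ |C| / n` of a code `C` of length `n = 2^m`. -/
def rate {m : ℕ} (C : Set (Cube m → ZMod 2)) : ℝ := Real.logb 2 C.ncard / 2 ^ m

/-! ### Successive decoding -/

/-- `P(U_A = a, Y^{(m)} = y, U_{<A} = w)`. -/
def bitLikelihood {𝒴 : Type*} [Fintype 𝒴] (W : BMSChannel 𝒴) {m : ℕ} (A : Finset (Fin m))
    (y : Cube m → 𝒴) (w : {B : Finset (Fin m) // RMLT B A} → ZMod 2) (a : ZMod 2) : ℝ :=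
  Pr (jointLaw W m) (fun ω => ω.1 A = a ∧ (ω.2, past A ω.1) = (y, w))

/-- The more likely value of a bit, where `t` is the value chosen in case of a tie. -/
def mapDecision (L : ZMod 2 → ℝ) (t : ZMod 2) : ZMod 2 :=
  if L 1 < L 0 then 0 else if L 0 < L 1 then 1 else t

/-- The successive decoder for information set `G`.  Indices are processed in the order `RMLT`;
an index outside `G` is known to carry `0`, and an index `A ∈ G` is estimated by maximum a
posteriori decision on `U_A` given the output `y` and the previous decisions.
The decision in case of a tie is prescribed by `tie`. -/
def successiveDecoder {𝒴 : Type*} [Fintype 𝒴] (W : BMSChannel 𝒴) {m : ℕ}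
    (G : Finset (Finset (Fin m))) (tie : (Cube m → 𝒴) → Finset (Fin m) → ZMod 2)
    (y : Cube m → 𝒴) : Finset (Fin m) → ZMod 2 :=
  (rmlt_wellFounded m).fix fun A prev =>
    if A ∈ G then mapDecision (bitLikelihood W A y fun B => prev B.1 B.2) (tie y A) else 0

/-- Block error probability of the successive decoder for information set `G`, for a uniformly
distributed message in `{0,1}^G` (extended by `0` outside `G`). -/
def blockError {𝒴 : Type*} [Fintype 𝒴] (W : BMSChannel 𝒴) {m : ℕ}
    (G : Finset (Finset (Fin m))) (tie : (Cube m → 𝒴) → Finset (Fin m) → ZMod 2) : ℝ :=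
  (1 / 2) ^ G.card *
    ∑ u : Finset (Fin m) → ZMod 2 with (∀ A, A ∉ G → u A = 0),
      ∑ y : Cube m → 𝒴 with successiveDecoder W G tie y ≠ u, wordProb W (encode u) y

end

end

end TwinCode

namespace TwinCode

noncomputable section

/-! ### Finite probability: Bhattacharyya parameters and entropies of one bit given an observation
-/

section Probability

open scoped Classical

variable {Ω Ω' β γ : Type*} [Fintype Ω] [Fintype Ω']

/-! Splitting the cube along any coordinate `i` turns level `m + 1` into two independent copies of
level `m` (the Plotkin recursion). For `i ∉ A` this gives `Z_A ≤ Z_{A ∪ {i}} ^ 2`, because of the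
order: the past of `A` in level `m + 1` knows at least as much as the plus transform, and the past
of `A ∪ {i}` knows at most as much as the minus transform helped by a genie, whose parameter is that
of level `m` (`Zparam_lift_le`, `le_Zparam_insert_lift`).

Hence `Z_A ≤ Z_B ^ 2` whenever `A ⊂ B`, so the sets with `c ^ 2 < Z_A ≤ c` form an antichain, and by
Sperner there are `O(n / √m)` of them. Squaring repeatedly, `O(log m)` such layers lead from a fixed
`c < 1` to below any power of `1/n`. So all but a vanishing fraction of the sets have `Z_A < δ_n` or
`Z_A > c`.

The chain rule fixes the total: the deficits `log 2 - H(U_A | Y, U_{<A})` sum to `n I(W) log 2`. A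
deficit is nearly `log 2` when `Z_A` is near `0` and nearly `0` when `Z_A` is near `1`
(`condEnt_bounds`), so the fraction of good sets tends to `I(W)`.

For decoding, channel symmetry makes the error probability of each bit independent of the
transmitted word, so freezing bits to `0` is harmless. A union bound over the first wrong decision
then bounds the block error by the sum of `Z_A` over the good sets, at most `n |δ_n|`. -/

theorem sum_zmod_two {M : Type*} [AddCommMonoid M] (f : ZMod 2 → M) : ∑ x, f x = f 0 + f 1 :=
  Fin.sum_univ_two f

theorem zmod_two_cases (x : ZMod 2) : x = 0 ∨ x = 1 := by
  revert x; decide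

theorem Pr_eq_sum_ite (P : Ω → ℝ) (E : Ω → Prop) : Pr P E = ∑ ω, if E ω then P ω else 0 :=
  Finset.sum_filter _ _

theorem Pr_congr {P : Ω → ℝ} {E F : Ω → Prop} (h : ∀ ω, E ω ↔ F ω) : Pr P E = Pr P F := by
  rw [funext fun ω => propext (h ω)]

theorem Pr_nonneg {P : Ω → ℝ} (hP : ∀ ω, 0 ≤ P ω) (E : Ω → Prop) : 0 ≤ Pr P E :=
  Finset.sum_nonneg fun ω _ => hP ω

theorem Pr_true (P : Ω → ℝ) : Pr P (fun _ => True) = ∑ ω, P ω := by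
  simp [Pr]

theorem Pr_eq (P : Ω → ℝ) (ω₀ : Ω) : Pr P (fun ω => ω = ω₀) = P ω₀ := by
  simp [Pr_eq_sum_ite]

theorem sum_Pr_and [Fintype β] (P : Ω → ℝ) (E : Ω → Prop) (V : Ω → β) :
    ∑ v, Pr P (fun ω => E ω ∧ V ω = v) = Pr P E := by
  simp only [Pr_eq_sum_ite]
  rw [Finset.sum_comm]
  refine Finset.sum_congr rfl fun ω _ => ?_
  by_cases h : E ω <;> simp [h]

theorem sum_Pr [Fintype β] (P : Ω → ℝ) (V : Ω → β) : ∑ v, Pr P (fun ω => V ω = v) = ∑ ω, P ω := by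
  have := sum_Pr_and P (fun _ => True) V
  simpa [Pr_true] using this

theorem Pr_and_comp [Fintype β] (P : Ω → ℝ) (E : Ω → Prop) (V : Ω → β) (g : β → γ) (c : γ) :
    Pr P (fun ω => E ω ∧ g (V ω) = c) = ∑ v with g v = c, Pr P (fun ω => E ω ∧ V ω = v) := by
  rw [← sum_Pr_and P _ V, Finset.sum_filter]
  refine Finset.sum_congr rfl fun v _ => ?_
  split_ifs with h
  · exact Pr_congr fun ω => ⟨fun h' => ⟨h'.1.1, h'.2⟩, fun h' => ⟨⟨h'.1, h'.2 ▸ h⟩, h'.2⟩⟩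
  · rw [Pr_eq_sum_ite]
    refine Finset.sum_eq_zero fun ω _ => if_neg ?_
    rintro ⟨⟨_, h'⟩, rfl⟩
    exact h h'

theorem Pr_eq_add (P : Ω → ℝ) (X : Ω → ZMod 2) (E : Ω → Prop) :
    Pr P E = Pr P (fun ω => X ω = 0 ∧ E ω) + Pr P (fun ω => X ω = 1 ∧ E ω) := by
  rw [← sum_Pr_and P E X, sum_zmod_two]
  simp only [and_comm]

theorem Pr_equiv (e : Ω ≃ Ω') (P : Ω' → ℝ) (E : Ω' → Prop) :
    Pr (fun ω => P (e ω)) (fun ω => E (e ω)) = Pr P E := by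
  simp only [Pr_eq_sum_ite]
  exact e.sum_comp fun ω => if E ω then P ω else 0

/-- The product of two laws. -/
def prodLaw {Ω Ω' : Type*} (P : Ω → ℝ) (Q : Ω' → ℝ) : Ω × Ω' → ℝ := fun ω => P ω.1 * Q ω.2

theorem Pr_prodLaw (P : Ω → ℝ) (Q : Ω' → ℝ) (E : Ω → Prop) (F : Ω' → Prop) :
    Pr (prodLaw P Q) (fun ω => E ω.1 ∧ F ω.2) = Pr P E * Pr Q F := by
  simp only [Pr_eq_sum_ite, prodLaw, Fintype.sum_prod_type, Finset.sum_mul_sum]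
  refine Finset.sum_congr rfl fun a _ => Finset.sum_congr rfl fun b _ => ?_
  by_cases h : E a <;> by_cases h' : F b <;> simp [h, h']

/-! ### Bhattacharyya sums of uniform bits -/

/-- The Bhattacharyya parameter of `X` given `V` for a uniform bit `X`. -/
def bhatt [Fintype β] (P : Ω → ℝ) (X : Ω → ZMod 2) (V : Ω → β) : ℝ :=
  2 * ∑ v, √(Pr P (fun ω => X ω = 0 ∧ V ω = v) * Pr P (fun ω => X ω = 1 ∧ V ω = v))

theorem bhattacharyya_eq_bhatt [Fintype β] {P : Ω → ℝ} {X : Ω → ZMod 2} (V : Ω → β)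
    (h₀ : Pr P (fun ω => X ω = 0) = 1 / 2) (h₁ : Pr P (fun ω => X ω = 1) = 1 / 2) :
    bhattacharyya P X V = bhatt P X V := by
  rw [bhattacharyya, bhatt, h₀, h₁, Finset.mul_sum]
  refine Finset.sum_congr rfl fun v _ => ?_
  rw [show ∀ a b : ℝ, a / (1 / 2) * (b / (1 / 2)) = 2 ^ 2 * (a * b) by intros; ring,
    Real.sqrt_mul (by norm_num), Real.sqrt_sq (by norm_num)]

theorem bhatt_nonneg [Fintype β] (P : Ω → ℝ) (X : Ω → ZMod 2) (V : Ω → β) : 0 ≤ bhatt P X V :=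
  mul_nonneg two_pos.le (Finset.sum_nonneg fun _ _ => Real.sqrt_nonneg _)

theorem two_mul_sqrt_mul_le_add {a b : ℝ} (ha : 0 ≤ a) (hb : 0 ≤ b) : 2 * √(a * b) ≤ a + b := by
  rw [Real.sqrt_mul ha]
  nlinarith [sq_nonneg (√a - √b), Real.sq_sqrt ha, Real.sq_sqrt hb]

theorem bhatt_le_sum [Fintype β] {P : Ω → ℝ} (hP : ∀ ω, 0 ≤ P ω) (X : Ω → ZMod 2) (V : Ω → β) :
    bhatt P X V ≤ ∑ ω, P ω := by
  rw [bhatt, Finset.mul_sum, ← sum_Pr P V]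
  refine Finset.sum_le_sum fun v _ => ?_
  rw [Pr_eq_add P X fun ω => V ω = v]
  exact two_mul_sqrt_mul_le_add (Pr_nonneg hP _) (Pr_nonneg hP _)

/-- Data processing: a coarser observation has a larger Bhattacharyya parameter. -/
theorem bhatt_mono [Fintype β] [Fintype γ] {P : Ω → ℝ} (hP : ∀ ω, 0 ≤ P ω) (X : Ω → ZMod 2) {V : Ω → β} {V' : Ω → γ}
    (h : ∀ ω ω', V ω = V ω' → V' ω = V' ω') : bhatt P X V ≤ bhatt P X V' := by
  rcases isEmpty_or_nonempty Ω with hΩ | ⟨⟨ω₀⟩⟩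
  · simp [bhatt, Pr]
  have : Nonempty γ := ⟨V' ω₀⟩
  obtain ⟨g, hg⟩ : ∃ g : β → γ, ∀ ω, g (V ω) = V' ω := by
    obtain ⟨g, hg⟩ := (Function.factorsThrough_iff (g := V') (f := V)).1 fun ω ω' => h ω ω'
    exact ⟨g, fun ω => (congrFun hg ω).symm⟩
  rw [bhatt, bhatt]
  refine mul_le_mul_of_nonneg_left ?_ two_pos.le
  rw [← Finset.sum_fiberwise Finset.univ g]
  refine Finset.sum_le_sum fun c _ => ?_
  simp only [← hg, Pr_and_comp P _ V g c]
  rw [Real.sqrt_mul (Finset.sum_nonneg fun _ _ => Pr_nonneg hP _)]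
  simp only [Real.sqrt_mul (Pr_nonneg hP _)]
  -- Cauchy–Schwarz on each fibre of `g`.
  exact Real.sum_sqrt_mul_sqrt_le _ (fun _ => Pr_nonneg hP _) fun _ => Pr_nonneg hP _

theorem bhatt_equiv [Fintype β] (e : Ω ≃ Ω') (P : Ω' → ℝ) (X : Ω' → ZMod 2) (V : Ω' → β) :
    bhatt (fun ω => P (e ω)) (fun ω => X (e ω)) (fun ω => V (e ω)) = bhatt P X V := by
  simp only [bhatt]
  congr 1
  refine Finset.sum_congr rfl fun v _ => ?_
  rw [← Pr_equiv e P fun ω => X ω = 0 ∧ V ω = v, ← Pr_equiv e P fun ω => X ω = 1 ∧ V ω = v]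

/-- Once the sum `s` is known, each value of the first bit determines the second, so the two joint
masses factor. Their product is the same for `s = 0` and `s = 1`. -/
theorem bhatt_prod_plus [Fintype β] {P : Ω → ℝ} (hP : ∀ ω, 0 ≤ P ω) (X : Ω → ZMod 2) (V : Ω → β) :
    bhatt (prodLaw P P) (fun ω => X ω.1) (fun ω => ((V ω.1, V ω.2), X ω.1 + X ω.2)) =
      bhatt P X V ^ 2 := by
  have key : ∀ a s v w, Pr (prodLaw P P)
      (fun ω => X ω.1 = a ∧ ((V ω.1, V ω.2), X ω.1 + X ω.2) = ((v, w), s)) =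
      Pr P (fun ω => X ω = a ∧ V ω = v) * Pr P (fun ω => X ω = s - a ∧ V ω = w) := by
    intro a s v w
    rw [← Pr_prodLaw]
    refine Pr_congr fun ω => ?_
    simp only [Prod.mk.injEq]
    constructor
    · rintro ⟨h, ⟨h1, h2⟩, h3⟩
      exact ⟨⟨h, h1⟩, by rw [← h3, h]; ring, h2⟩
    · rintro ⟨⟨h, h1⟩, h3, h2⟩
      exact ⟨h, ⟨h1, h2⟩, by rw [h, h3]; ring⟩
  rw [bhatt, bhatt, Fintype.sum_prod_type]
  simp only [Fintype.sum_prod_type, sum_zmod_two, key]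
  rw [mul_pow, sq (∑ v, _), Finset.sum_mul_sum, show (2 : ℝ) ^ 2 = 2 * 2 by norm_num, mul_assoc]
  congr 1
  rw [Finset.mul_sum]
  refine Finset.sum_congr rfl fun v _ => ?_
  rw [Finset.mul_sum]
  refine Finset.sum_congr rfl fun w _ => ?_
  rw [← Real.sqrt_mul (mul_nonneg (Pr_nonneg hP _) (Pr_nonneg hP _)),
    show (0 : ZMod 2) - 1 = 1 by decide, show (1 : ZMod 2) - 1 = 0 by decide,
    show (0 : ZMod 2) - 0 = 0 by decide, show (1 : ZMod 2) - 0 = 1 by decide, two_mul]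
  congr 2 <;> ring

/-- This is the minus transform with a genie that reveals the second bit. Then `X ω.1 + X ω.2` is
the first bit shifted by a known amount, and the second copy carries no further information on it.
-/
theorem bhatt_prod_minus [Fintype β] {P : Ω → ℝ} (hP : ∀ ω, 0 ≤ P ω) (h1 : ∑ ω, P ω = 1)
    (X : Ω → ZMod 2) (V : Ω → β) :
    bhatt (prodLaw P P) (fun ω => X ω.1 + X ω.2) (fun ω => ((V ω.1, V ω.2), X ω.2)) =
      bhatt P X V := by
  have key : ∀ a b v w, Pr (prodLaw P P)
      (fun ω => X ω.1 + X ω.2 = a ∧ ((V ω.1, V ω.2), X ω.2) = ((v, w), b)) =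
      Pr P (fun ω => X ω = a - b ∧ V ω = v) * Pr P (fun ω => X ω = b ∧ V ω = w) := by
    intro a b v w
    rw [← Pr_prodLaw]
    refine Pr_congr fun ω => ?_
    simp only [Prod.mk.injEq]
    constructor
    · rintro ⟨h, ⟨h1, h2⟩, h3⟩
      exact ⟨⟨by rw [← h, ← h3]; ring, h1⟩, h3, h2⟩
    · rintro ⟨⟨h, h1⟩, h3, h2⟩
      exact ⟨by rw [h, h3]; ring, ⟨h1, h2⟩, h3⟩
  rw [bhatt, bhatt, Fintype.sum_prod_type]
  simp only [Fintype.sum_prod_type, sum_zmod_two, key]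
  congr 1
  refine Finset.sum_congr rfl fun v _ => ?_
  rw [← mul_one √_, ← h1, ← sum_Pr P V, Finset.mul_sum]
  refine Finset.sum_congr rfl fun w _ => ?_
  rw [Pr_eq_add P X fun ω => V ω = w, mul_add,
    show (0 : ZMod 2) - 1 = 1 by decide, show (1 : ZMod 2) - 1 = 0 by decide,
    show (0 : ZMod 2) - 0 = 0 by decide, show (1 : ZMod 2) - 0 = 1 by decide,
    mul_mul_mul_comm, mul_mul_mul_comm (Pr P fun ω => X ω = 1 ∧ V ω = v),
    Real.sqrt_mul (mul_nonneg (Pr_nonneg hP _) (Pr_nonneg hP _)),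
    Real.sqrt_mul (mul_nonneg (Pr_nonneg hP _) (Pr_nonneg hP _)),
    Real.sqrt_mul_self (Pr_nonneg hP _), Real.sqrt_mul_self (Pr_nonneg hP _),
    mul_comm (Pr P fun ω => X ω = 1 ∧ V ω = v)]

/-! ### Entropy, in nats -/

/-- The entropy of `V`, in nats. It depends only on the partition of `Ω` into the fibres of `V`. -/
def ent (P : Ω → ℝ) (V : Ω → β) : ℝ := -∑ ω, P ω * Real.log (Pr P (fun ω' => V ω' = V ω))

theorem ent_congr (P : Ω → ℝ) {V : Ω → β} {V' : Ω → γ}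
    (h : ∀ ω ω', V ω = V ω' ↔ V' ω = V' ω') : ent P V = ent P V' := by
  simp only [ent, h]

theorem ent_eq_sum [Fintype β] (P : Ω → ℝ) (V : Ω → β) :
    ent P V = ∑ v, Real.negMulLog (Pr P (fun ω => V ω = v)) := by
  rw [ent, ← Finset.sum_fiberwise Finset.univ V, ← Finset.sum_neg_distrib]
  refine Finset.sum_congr rfl fun v _ => ?_
  rw [Real.negMulLog, neg_mul, Pr, Finset.sum_mul]
  congr 1
  refine Finset.sum_congr (by ext; simp) fun ω hω => ?_
  rw [(Finset.mem_filter.1 hω).2]; rfl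

theorem ent_equiv (e : Ω ≃ Ω') (P : Ω' → ℝ) (V : Ω' → β) :
    ent (fun ω => P (e ω)) (fun ω => V (e ω)) = ent P V := by
  rw [ent, ent, ← e.sum_comp]
  congr 1
  refine Finset.sum_congr rfl fun ω _ => ?_
  rw [← Pr_equiv e P]

theorem ent_prodLaw {P : Ω → ℝ} (hP : ∀ ω, 0 ≤ P ω) (h1 : ∑ ω, P ω = 1) (V : Ω → β) :
    ent (prodLaw P P) (fun ω => (V ω.1, V ω.2)) = 2 * ent P V := by
  have hpos : ∀ a, P a ≠ 0 → Pr P (fun ω' => V ω' = V a) ≠ 0 := fun a ha => by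
    refine ne_of_gt (lt_of_lt_of_le (lt_of_le_of_ne (hP a) ha.symm) ?_)
    exact Finset.single_le_sum (f := P) (fun ω _ => hP ω) (by simp)
  have key : ∀ a b, prodLaw P P (a, b) *
      Real.log (Pr (prodLaw P P) fun ω => (V ω.1, V ω.2) = (V a, V b)) =
      P a * Real.log (Pr P fun ω => V ω = V a) * P b +
        P a * (P b * Real.log (Pr P fun ω => V ω = V b)) := by
    intro a b
    simp only [Prod.mk.injEq, Pr_prodLaw P P (fun ω => V ω = V a) fun ω => V ω = V b]
    simp only [prodLaw]
    by_cases ha : P a = 0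
    · simp [ha]
    by_cases hb : P b = 0
    · simp [hb]
    rw [Real.log_mul (hpos a ha) (hpos b hb)]
    ring
  simp only [ent, Fintype.sum_prod_type, key, Finset.sum_add_distrib]
  simp only [← Finset.mul_sum, ← Finset.sum_mul, h1]
  ring

/-- The conditional entropy of `X` given `V`, in nats. -/
def condEnt (P : Ω → ℝ) (X : Ω → ZMod 2) (V : Ω → β) : ℝ := ent P (fun ω => (X ω, V ω)) - ent P V

theorem condEnt_eq_sum [Fintype β] (P : Ω → ℝ) (X : Ω → ZMod 2) (V : Ω → β) :
    condEnt P X V = ∑ v, (Real.negMulLog (Pr P fun ω => X ω = 0 ∧ V ω = v) +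
      Real.negMulLog (Pr P fun ω => X ω = 1 ∧ V ω = v) -
      Real.negMulLog (Pr P (fun ω => X ω = 0 ∧ V ω = v) + Pr P fun ω => X ω = 1 ∧ V ω = v)) := by
  rw [condEnt, ent_eq_sum, ent_eq_sum, Fintype.sum_prod_type, Finset.sum_comm,
    ← Finset.sum_sub_distrib]
  refine Finset.sum_congr rfl fun v _ => ?_
  simp only [sum_zmod_two, Prod.mk.injEq, ← Pr_eq_add P X]

theorem mul_log_sub_log_le {p r : ℝ} (hp : 0 ≤ p) (hr : 0 < r) :
    p * (Real.log r - Real.log p) ≤ r - p := by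
  rcases hp.eq_or_lt with rfl | hp
  · simpa using hr.le
  rw [← Real.log_div hr.ne' hp.ne']
  have := mul_le_mul_of_nonneg_left (Real.log_le_sub_one_of_pos (div_pos hr hp)) hp.le
  rwa [mul_sub, mul_div_cancel₀ _ hp.ne', mul_one] at this

theorem mul_log_sub_log_ge {p r : ℝ} (hp : 0 ≤ p) (hr : 0 < r) :
    p * (Real.log p - Real.log r) ≤ p * (p / r - 1) := by
  rcases hp.eq_or_lt with rfl | hp
  · simp
  rw [← Real.log_div hp.ne' hr.ne']
  exact mul_le_mul_of_nonneg_left (Real.log_le_sub_one_of_pos (div_pos hp hr)) hp.le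

/-- The linear bound is applied to `√p` and `√s` and multiplied by `√p`; this produces the square
roots needed to compare entropy with a Bhattacharyya sum. -/
theorem two_mul_mul_log_sqrt_le {p s : ℝ} (hp : 0 ≤ p) (hs : 0 < s) :
    p * (Real.log s - Real.log p) ≤ 2 * √p * (√s - √p) := by
  have h := mul_log_sub_log_le (Real.sqrt_nonneg p) (Real.sqrt_pos.2 hs)
  have h2 := mul_le_mul_of_nonneg_left h (Real.sqrt_nonneg p)
  rw [Real.log_sqrt hs.le, Real.log_sqrt hp, ← mul_assoc, Real.mul_self_sqrt hp] at h2
  linarith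

/-- The unnormalized binary entropy of the masses `p` and `q`, in nats. -/
def splitEnt (p q : ℝ) : ℝ := Real.negMulLog p + Real.negMulLog q - Real.negMulLog (p + q)

theorem splitEnt_eq (p q : ℝ) : splitEnt p q =
    p * (Real.log (p + q) - Real.log p) + q * (Real.log (p + q) - Real.log q) := by
  simp only [splitEnt, Real.negMulLog]; ring

theorem splitEnt_bounds {p q : ℝ} (hp : 0 ≤ p) (hq : 0 ≤ q) :
    0 ≤ splitEnt p q ∧ splitEnt p q ≤ (p + q) * Real.log 2 ∧ splitEnt p q ≤ 2 * √(p * q) ∧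
      (p + q) * Real.log 2 - splitEnt p q ≤ 2 * ((p + q) - 2 * √(p * q)) := by
  rcases (add_nonneg hp hq).eq_or_lt with h | hs
  · obtain rfl : p = 0 := by linarith
    obtain rfl : q = 0 := by linarith
    simp [splitEnt]
  rw [splitEnt_eq]
  have hlog : Real.log ((p + q) / 2) = Real.log (p + q) - Real.log 2 :=
    Real.log_div hs.ne' two_ne_zero
  refine ⟨?_, ?_, ?_, ?_⟩
  · have key : ∀ r, 0 ≤ r → r ≤ p + q → 0 ≤ r * (Real.log (p + q) - Real.log r) := by
      intro r hr hrs
      rcases hr.eq_or_lt with rfl | hr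
      · simp
      · exact mul_nonneg hr.le (sub_nonneg.2 (Real.log_le_log hr hrs))
    exact add_nonneg (key p hp (by linarith)) (key q hq (by linarith))
  · have h1 := mul_log_sub_log_le hp (half_pos hs)
    have h2 := mul_log_sub_log_le hq (half_pos hs)
    rw [hlog] at h1 h2
    linarith
  -- With `s = p + q`, the two bounds add up to `2√s(√p + √q) - 2s`, and `(√p + √q - √s)² ≥ 0`
  -- finishes.
  · have h1 := two_mul_mul_log_sqrt_le hp hs
    have h2 := two_mul_mul_log_sqrt_le hq hs
    rw [Real.sqrt_mul hp]
    nlinarith [sq_nonneg (√p + √q - √(p + q)), Real.sq_sqrt hp, Real.sq_sqrt hq,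
      Real.sq_sqrt hs.le]
  -- The left side is the divergence of `(p, q)` from the equal split, bounded by its chi-square
  -- counterpart `(s² - t²)/s` with `s = p + q`, `t = 2√(pq)`. This is at most `2(s - t)`.
  · have h1 := mul_log_sub_log_ge hp (half_pos hs)
    have h2 := mul_log_sub_log_ge hq (half_pos hs)
    rw [hlog] at h1 h2
    have h3 := two_mul_sqrt_mul_le_add hp hq
    have h4 : p * (p / ((p + q) / 2) - 1) + q * (q / ((p + q) / 2) - 1) ≤
        2 * ((p + q) - 2 * √(p * q)) := by
      have : p * (p / ((p + q) / 2) - 1) + q * (q / ((p + q) / 2) - 1) =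
          ((p + q) ^ 2 - (2 * √(p * q)) ^ 2) / (p + q) := by
        rw [mul_pow, Real.sq_sqrt (mul_nonneg hp hq)]
        field_simp
        ring
      rw [this, div_le_iff₀ hs]
      nlinarith [sq_nonneg (p + q - 2 * √(p * q))]
    linarith

/-- The pointwise bounds of `splitEnt_bounds` are summed over the observations. The last two tie
both extremes together: `Z` near `0` forces entropy near `0`, and `Z` near `1` forces a nearly full
bit. -/
theorem condEnt_bounds [Fintype β] {P : Ω → ℝ} (hP : ∀ ω, 0 ≤ P ω) (h1 : ∑ ω, P ω = 1)
    (X : Ω → ZMod 2) (V : Ω → β) :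
    0 ≤ condEnt P X V ∧ condEnt P X V ≤ Real.log 2 ∧ condEnt P X V ≤ bhatt P X V ∧
      Real.log 2 - condEnt P X V ≤ 2 * (1 - bhatt P X V) := by
  have hs : ∑ v, ((Pr P fun ω => X ω = 0 ∧ V ω = v) + Pr P fun ω => X ω = 1 ∧ V ω = v) = 1 := by
    simp only [← Pr_eq_add P X, sum_Pr, h1]
  have hb := fun v => splitEnt_bounds (Pr_nonneg hP fun ω => X ω = 0 ∧ V ω = v)
    (Pr_nonneg hP fun ω => X ω = 1 ∧ V ω = v)
  have hc : condEnt P X V = ∑ v, splitEnt (Pr P fun ω => X ω = 0 ∧ V ω = v)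
      (Pr P fun ω => X ω = 1 ∧ V ω = v) := condEnt_eq_sum P X V
  rw [hc, bhatt, Finset.mul_sum]
  refine ⟨Finset.sum_nonneg fun v _ => (hb v).1, ?_, Finset.sum_le_sum fun v _ => (hb v).2.2.1, ?_⟩
  · refine (Finset.sum_le_sum fun v _ => (hb v).2.1).trans ?_
    rw [← Finset.sum_mul, hs, one_mul]
  · have := Finset.sum_le_sum fun v (_ : v ∈ Finset.univ) => (hb v).2.2.2
    rw [Finset.sum_sub_distrib, ← Finset.sum_mul, ← Finset.mul_sum, Finset.sum_sub_distrib, hs,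
      one_mul] at this
    exact this

/-- Telescoping along a finite strict total order. -/
theorem sum_insert_sub {ι : Type*} [Fintype ι] (r : ι → ι → Prop) [IsStrictTotalOrder ι r]
    (F : Finset ι → ℝ) :
    ∑ a, (F (insert a ({b | r b a} : Finset ι)) - F {b | r b a}) = F Finset.univ - F ∅ := by
  have key : ∀ (k : ℕ) (S : Finset ι), S.card = k → (∀ a ∈ S, ∀ b, r b a → b ∈ S) →
      ∑ a ∈ S, (F (insert a ({b | r b a} : Finset ι)) - F {b | r b a}) = F S - F ∅ := by
    intro k
    induction k with
    | zero =>
      intro S hS _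
      rw [Finset.card_eq_zero.1 hS]; simp
    | succ k ih =>
      intro S hS hr
      have hne : S.Nonempty := Finset.card_pos.1 (by omega)
      -- For a maximal element of a down-closed set, the predecessors are exactly the rest of the
      -- set.
      obtain ⟨a, haS, hmax⟩ : ∃ a ∈ S, ∀ b ∈ S, ¬ r a b := by
        have hwf : WellFounded (Function.swap r) := Finite.wellFounded_of_trans_of_irrefl _
        obtain ⟨a, ha, h⟩ := hwf.has_min (S : Set ι) hne
        exact ⟨a, ha, fun b hb => h b hb⟩
      have hlt : ({b | r b a} : Finset ι) = S.erase a := by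
        ext b
        simp only [Finset.mem_filter, Finset.mem_univ, true_and, Finset.mem_erase]
        constructor
        · intro h
          exact ⟨fun hb => irrefl_of r a (hb ▸ h), hr a haS b h⟩
        · rintro ⟨h, hb⟩
          rcases trichotomous_of r b a with h' | h' | h'
          · exact h'
          · exact absurd h' h
          · exact absurd h' (hmax b hb)
      rw [← Finset.add_sum_erase S _ haS, ih _ (by rw [Finset.card_erase_of_mem haS]; omega),
        hlt, Finset.insert_erase haS]
      · ring
      · intro c hc b hbc
        have hcS := Finset.mem_of_mem_erase hc
        refine Finset.mem_erase.2 ⟨?_, hr c hcS b hbc⟩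
        rintro rfl
        exact hmax c hcS hbc
  exact key _ Finset.univ rfl fun _ _ _ _ => Finset.mem_univ _

end Probability

/-! ### Splitting along a coordinate, and the squaring inequality for `Zparam` -/

section Splitting

open scoped Classical

variable {m : ℕ} {𝒴 : Type*}

/-- The subset of `[m+1] ∖ {i}` corresponding to a subset of `[m]`. -/
def lift (i : Fin (m + 1)) (A : Finset (Fin m)) : Finset (Fin (m + 1)) := A.image i.succAbove

/-- The subset of `[m]` corresponding to `B ∖ {i}`. -/
def drop (i : Fin (m + 1)) (B : Finset (Fin (m + 1))) : Finset (Fin m) :=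
  {j | i.succAbove j ∈ B}

theorem notMem_lift (i : Fin (m + 1)) (A : Finset (Fin m)) : i ∉ lift i A := by
  simp [lift, Fin.succAbove_ne]

theorem succAbove_mem_lift (i : Fin (m + 1)) (A : Finset (Fin m)) (j : Fin m) :
    i.succAbove j ∈ lift i A ↔ j ∈ A := by
  simp [lift, Fin.succAbove_right_injective.eq_iff]

theorem drop_lift (i : Fin (m + 1)) (A : Finset (Fin m)) : drop i (lift i A) = A := by
  ext j; simp [drop, succAbove_mem_lift]

theorem drop_insert_lift (i : Fin (m + 1)) (A : Finset (Fin m)) :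
    drop i (insert i (lift i A)) = A := by
  ext j; simp [drop, succAbove_mem_lift, Fin.succAbove_ne]

theorem lift_drop {i : Fin (m + 1)} {B : Finset (Fin (m + 1))} (h : i ∉ B) :
    lift i (drop i B) = B := by
  ext j
  rcases Fin.eq_self_or_eq_succAbove i j with rfl | ⟨j, rfl⟩
  · simp [notMem_lift, h]
  · simp [succAbove_mem_lift, drop]

theorem insert_lift_drop {i : Fin (m + 1)} {B : Finset (Fin (m + 1))} (h : i ∈ B) :
    insert i (lift i (drop i B)) = B := by
  ext j
  rcases Fin.eq_self_or_eq_succAbove i j with rfl | ⟨j, rfl⟩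
  · simp [h]
  · simp [succAbove_mem_lift, drop, Fin.succAbove_ne]

theorem card_lift (i : Fin (m + 1)) (A : Finset (Fin m)) : (lift i A).card = A.card :=
  Finset.card_image_of_injective _ Fin.succAbove_right_injective

theorem card_insert_lift (i : Fin (m + 1)) (A : Finset (Fin m)) :
    (insert i (lift i A)).card = A.card + 1 := by
  rw [Finset.card_insert_of_notMem (notMem_lift i A), card_lift]

theorem toColex_lift_lt (i : Fin (m + 1)) (A B : Finset (Fin m)) :
    toColex (lift i A) < toColex (lift i B) ↔ toColex A < toColex B :=
  Finset.Colex.toColex_image_lt_toColex_image (Fin.strictMono_succAbove i)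

theorem toColex_insert_lift_lt (i : Fin (m + 1)) (A B : Finset (Fin m)) :
    toColex (insert i (lift i A)) < toColex (insert i (lift i B)) ↔ toColex A < toColex B := by
  rw [← toColex_lift_lt i, ← Finset.Colex.toColex_sdiff_lt_toColex_sdiff (u := {i})
    (by simp) (by simp)]
  simp [Finset.sdiff_singleton_eq_erase, notMem_lift]

theorem rmlt_lift (i : Fin (m + 1)) (A B : Finset (Fin m)) :
    RMLT (lift i A) (lift i B) ↔ RMLT A B := by
  simp only [RMLT, card_lift, toColex_lift_lt]

theorem rmlt_insert_lift (i : Fin (m + 1)) (A B : Finset (Fin m)) :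
    RMLT (insert i (lift i A)) (insert i (lift i B)) ↔ RMLT A B := by
  simp only [RMLT, card_insert_lift, toColex_insert_lift_lt, add_lt_add_iff_right,
    add_left_inj]

theorem rmlt_insert_lift_self (i : Fin (m + 1)) (A : Finset (Fin m)) :
    RMLT (insert i (lift i A)) (lift i A) :=
  Or.inl (by rw [card_lift, card_insert_lift]; omega)

theorem rmlt_trans {A B C : Finset (Fin m)} (h : RMLT A B) (h' : RMLT B C) : RMLT A C := by
  rcases h with h | ⟨h, h₁⟩ <;> rcases h' with h' | ⟨h', h₂⟩
  · exact Or.inl (by omega)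
  · exact Or.inl (by omega)
  · exact Or.inl (by omega)
  · exact Or.inr ⟨by omega, h₁.trans h₂⟩

theorem rmlt_irrefl (A : Finset (Fin m)) : ¬ RMLT A A := by
  rintro (h | h)
  · exact lt_irrefl _ h
  · exact lt_irrefl _ h.2

instance : IsStrictTotalOrder (Finset (Fin m)) RMLT where
  irrefl := rmlt_irrefl
  trans _ _ _ := rmlt_trans
  trichotomous A B h h' := by
    by_contra hne
    simp only [RMLT, not_or, not_and, not_lt] at h h'
    have hc : A.card = B.card := by omega
    exact hne (toColex.injective (le_antisymm (h'.2 hc.symm) (h.2 hc)))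

/-- Such a `C` has at least `|A| + 1` elements, so cardinality alone puts it before `A`. This is
where decreasing size in the order matters. -/
theorem rmlt_of_rmlt_insert_lift {i : Fin (m + 1)} {A C : Finset (Fin m)}
    (h : RMLT (lift i C) (insert i (lift i A))) : RMLT C A := by
  rw [RMLT, card_lift, card_insert_lift] at h
  exact Or.inl (by omega)

theorem sum_finset_succ {M : Type*} [AddCommMonoid M] (i : Fin (m + 1))
    (f : Finset (Fin (m + 1)) → M) :
    ∑ B, f B = ∑ A, f (lift i A) + ∑ A, f (insert i (lift i A)) := by
  rw [← Finset.sum_filter_not_add_sum_filter _ fun B : Finset (Fin (m + 1)) => i ∈ B]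
  congr 1
  · refine Finset.sum_bij' (fun B _ => drop i B) (fun A _ => lift i A) ?_ ?_ ?_ ?_ ?_
    · simp
    · simp [notMem_lift]
    · intro B hB; exact lift_drop (by simpa using hB)
    · intro A _; exact drop_lift i A
    · intro B hB; rw [lift_drop (by simpa using hB)]
  · refine Finset.sum_bij' (fun B _ => drop i B) (fun A _ => insert i (lift i A)) ?_ ?_ ?_ ?_ ?_
    · simp
    · simp
    · intro B hB; exact insert_lift_drop (by simpa using hB)
    · intro A _; exact drop_insert_lift i A
    · intro B hB; rw [insert_lift_drop (by simpa using hB)]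

/-- Splitting of the bits into the bits encoded on the half-cubes `z_i = 0` and `z_i = 1`. -/
def splitBits (i : Fin (m + 1)) : (Finset (Fin (m + 1)) → ZMod 2) ≃
    (Finset (Fin m) → ZMod 2) × (Finset (Fin m) → ZMod 2) where
  toFun u := (fun A => u (lift i A), fun A => u (lift i A) + u (insert i (lift i A)))
  invFun w := fun B => if i ∈ B then w.1 (drop i B) + w.2 (drop i B) else w.1 (drop i B)
  left_inv u := by
    funext B
    by_cases h : i ∈ B
    · simp only [h, if_true, ← add_assoc, CharTwo.add_self_eq_zero, zero_add, insert_lift_drop h]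
    · simp only [h, if_false, lift_drop h]
  right_inv w := by
    ext A
    · simp [notMem_lift, drop_lift]
    · simp [notMem_lift, drop_lift, drop_insert_lift, ← add_assoc, CharTwo.add_self_eq_zero]

/-- Splitting of a function on the cube into its restrictions to two half-cubes. -/
def splitWord (i : Fin (m + 1)) (α : Type*) :
    (Cube (m + 1) → α) ≃ (Cube m → α) × (Cube m → α) where
  toFun y := (fun z => y (i.insertNth 0 z), fun z => y (i.insertNth 1 z))
  invFun w := fun z => if z i = 0 then w.1 (i.removeNth z) else w.2 (i.removeNth z)
  left_inv y := by
    funext z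
    rcases zmod_two_cases (z i) with h | h
    · simp only [h, if_true]
      rw [← h, Fin.insertNth_self_removeNth]
    · simp only [h, one_ne_zero, if_false]
      rw [← h, Fin.insertNth_self_removeNth]
  right_inv w := by
    ext z <;> simp

theorem row_lift (i : Fin (m + 1)) (A : Finset (Fin m)) (b : ZMod 2) (z : Cube m) :
    row (lift i A) (i.insertNth b z : Cube (m + 1)) = row A z := by
  rw [row, lift, Finset.prod_image fun _ _ _ _ h => Fin.succAbove_right_injective h]
  simp [row]

theorem row_insert_lift (i : Fin (m + 1)) (A : Finset (Fin m)) (b : ZMod 2) (z : Cube m) :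
    row (insert i (lift i A)) (i.insertNth b z : Cube (m + 1)) = b * row A z := by
  rw [← row_lift i A b z, row, Finset.prod_insert (notMem_lift i A)]
  simp [row]

/-- The Plotkin construction: a monomial containing `z_i` vanishes on `z_i = 0` and loses that
factor on `z_i = 1`. -/
theorem splitWord_encode (i : Fin (m + 1)) (u : Finset (Fin (m + 1)) → ZMod 2) :
    splitWord i _ (encode u) = (encode (splitBits i u).1, encode (splitBits i u).2) := by
  ext z
  · simp [splitWord, encode, splitBits, sum_finset_succ i, row_lift, row_insert_lift]
  · simp [splitWord, encode, splitBits, sum_finset_succ i, row_lift, row_insert_lift, add_mul,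
      Finset.sum_add_distrib]

theorem encode_zero (u : Finset (Fin 0) → ZMod 2) (z : Cube 0) : encode u z = u ∅ := by
  rw [encode, Fintype.sum_eq_single ∅ fun A hA => absurd (Subsingleton.elim A ∅) hA]
  simp [row]

theorem encode_injective : ∀ m, Function.Injective (encode (m := m))
  | 0 => fun u v h => by
    funext A
    rw [Subsingleton.elim A ∅, ← encode_zero u 0, h, encode_zero]
  | m + 1 => fun u v h => by
    have h' := splitWord_encode 0 u
    rw [h, splitWord_encode 0 v, Prod.mk.injEq] at h'
    exact ((splitBits 0).injective (Prod.ext (encode_injective m h'.1) (encode_injective m h'.2))).symm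

/-- Splitting of the sample space of `(U^{(m+1)}, Y^{(m+1)})` at the coordinate `i`. -/
def splitSpace (i : Fin (m + 1)) (𝒴 : Type*) :
    (Finset (Fin (m + 1)) → ZMod 2) × (Cube (m + 1) → 𝒴) ≃
      ((Finset (Fin m) → ZMod 2) × (Cube m → 𝒴)) × ((Finset (Fin m) → ZMod 2) × (Cube m → 𝒴)) :=
  ((splitBits i).prodCongr (splitWord i 𝒴)).trans (Equiv.prodProdProdComm _ _ _ _)

/-- The restriction of the bits to the indices preceding `A`, together with the output. -/
def observation (A : Finset (Fin m)) (ω : (Finset (Fin m) → ZMod 2) × (Cube m → 𝒴)) :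
    (Cube m → 𝒴) × ({B : Finset (Fin m) // RMLT B A} → ZMod 2) := (ω.2, past A ω.1)

theorem observation_eq_iff {A : Finset (Fin m)} {ω ω' : (Finset (Fin m) → ZMod 2) × (Cube m → 𝒴)} :
    observation A ω = observation A ω' ↔ ω.2 = ω'.2 ∧ ∀ B, RMLT B A → ω.1 B = ω'.1 B := by
  rw [observation, observation, Prod.mk.injEq]
  simp only [past, funext_iff, Subtype.forall]

variable [Fintype 𝒴] (W : BMSChannel 𝒴)

theorem wordProb_splitWord (i : Fin (m + 1)) (x : Cube (m + 1) → ZMod 2) (y : Cube (m + 1) → 𝒴) :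
    wordProb W x y = wordProb W (splitWord i _ x).1 (splitWord i _ y).1 *
      wordProb W (splitWord i _ x).2 (splitWord i _ y).2 := by
  rw [wordProb, ← (Fin.insertNthEquiv (fun _ => ZMod 2) i).prod_comp, Fintype.prod_prod_type]
  exact Fin.prod_univ_two _

theorem jointLaw_split (i : Fin (m + 1)) :
    jointLaw W (m + 1) = fun ω => prodLaw (jointLaw W m) (jointLaw W m) (splitSpace i 𝒴 ω) := by
  funext ω
  have h := splitWord_encode i ω.1
  simp only [jointLaw, prodLaw, wordProb_splitWord W i (encode ω.1), h]
  simp only [splitSpace, Equiv.trans_apply, Equiv.prodCongr_apply, Equiv.prodProdProdComm_apply,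
    Prod.map]
  rw [pow_succ 2 m, pow_mul, sq]
  ring

theorem wordProb_nonneg (x : Cube m → ZMod 2) (y : Cube m → 𝒴) : 0 ≤ wordProb W x y :=
  Finset.prod_nonneg fun _ _ => W.nonneg _ _

theorem sum_wordProb (x : Cube m → ZMod 2) : ∑ y, wordProb W x y = 1 := by
  simp only [wordProb]
  rw [← Fintype.prod_sum]
  simp [W.sum_eq_one]

theorem jointLaw_nonneg (ω) : 0 ≤ jointLaw W m ω :=
  mul_nonneg (by positivity) (wordProb_nonneg W _ _)

theorem card_bits (m : ℕ) : Fintype.card (Finset (Fin m) → ZMod 2) = 2 ^ 2 ^ m := by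
  simp [ZMod.card]

theorem sum_jointLaw : ∑ ω, jointLaw W m ω = 1 := by
  simp only [Fintype.sum_prod_type, jointLaw, ← Finset.mul_sum, sum_wordProb]
  rw [Finset.sum_const, Finset.card_univ, card_bits]
  simp

theorem Pr_bit (A : Finset (Fin m)) (a : ZMod 2) :
    Pr (jointLaw W m) (fun ω => ω.1 A = a) = 1 / 2 := by
  have hsame : ∀ a, Pr (jointLaw W m) (fun ω => ω.1 A = a) =
      Pr (jointLaw W m) (fun ω => ω.1 A = 0) := by
    intro a
    simp only [Pr_eq_sum_ite, Fintype.sum_prod_type, jointLaw]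
    -- Flipping only the bit at `A` preserves the uniform law, and the output masses sum to `1` for
    -- every word.
    rw [← (Equiv.subRight (Pi.single A a)).sum_comp fun u : Finset (Fin m) → ZMod 2 =>
      ∑ y, if u A = 0 then (1 / 2) ^ (2 ^ m) * wordProb W (encode u) y else 0]
    refine Finset.sum_congr rfl fun u _ => ?_
    by_cases h : u A = a
    · simp [h, ← Finset.mul_sum, sum_wordProb]
    · have : u A - a ≠ 0 := sub_ne_zero.2 h
      simp [h, this]
  have hsum := sum_Pr (jointLaw W m) fun ω => ω.1 A
  rw [sum_zmod_two, hsame 1, sum_jointLaw] at hsum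
  rw [hsame a]
  linarith

theorem Zparam_eq_bhatt (A : Finset (Fin m)) :
    Zparam W A = bhatt (jointLaw W m) (fun ω => ω.1 A) (observation A) :=
  bhattacharyya_eq_bhatt _ (Pr_bit W A 0) (Pr_bit W A 1)

theorem Zparam_nonneg (A : Finset (Fin m)) : 0 ≤ Zparam W A := by
  rw [Zparam_eq_bhatt]; exact bhatt_nonneg _ _ _

theorem Zparam_le_one (A : Finset (Fin m)) : Zparam W A ≤ 1 := by
  rw [Zparam_eq_bhatt, ← sum_jointLaw W (m := m)]; exact bhatt_le_sum (jointLaw_nonneg W) _ _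

/-- The past of `lift i A` contains the bit of `A ∪ {i}`, which is the sum of the two copies' bits
at `A`, and both lifts of each `B` before `A`. It therefore refines the observation in
`bhatt_prod_plus`. -/
theorem Zparam_lift_le (i : Fin (m + 1)) (A : Finset (Fin m)) :
    Zparam W (lift i A) ≤ Zparam W A ^ 2 := by
  rw [Zparam_eq_bhatt, Zparam_eq_bhatt, ← bhatt_prod_plus (jointLaw_nonneg W),
    ← bhatt_equiv (splitSpace i 𝒴), ← jointLaw_split W i]
  refine bhatt_mono (jointLaw_nonneg W) _ fun ω ω' h => ?_
  rw [observation_eq_iff] at h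
  obtain ⟨hy, hu⟩ := h
  have h1 : ∀ B, RMLT B A → ω.1 (lift i B) = ω'.1 (lift i B) :=
    fun B hB => hu _ ((rmlt_lift i B A).2 hB)
  have h2 : ∀ B, RMLT B A → ω.1 (insert i (lift i B)) = ω'.1 (insert i (lift i B)) :=
    fun B hB => hu _ (rmlt_trans ((rmlt_insert_lift i B A).2 hB) (rmlt_insert_lift_self i A))
  have h3 := hu _ (rmlt_insert_lift_self i A)
  simp only [Prod.mk.injEq, observation_eq_iff]
  refine ⟨⟨⟨?_, h1⟩, ?_, fun B hB => ?_⟩, ?_⟩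
  · simp [splitSpace, hy]
  · simp [splitSpace, hy]
  · simp [splitSpace, splitBits, h1 B hB, h2 B hB]
  · simp [splitSpace, splitBits, ← add_assoc, CharTwo.add_self_eq_zero, h3]

/-- Conversely, all that precedes `A ∪ {i}` is a function of the two copies' pasts of `A`, so its
observation is coarser than the one in `bhatt_prod_minus`. -/
theorem le_Zparam_insert_lift (i : Fin (m + 1)) (A : Finset (Fin m)) :
    Zparam W A ≤ Zparam W (insert i (lift i A)) := by
  rw [Zparam_eq_bhatt, Zparam_eq_bhatt,
    ← bhatt_prod_minus (jointLaw_nonneg W) (sum_jointLaw W),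
    ← bhatt_equiv (splitSpace i 𝒴), ← jointLaw_split W i]
  have hX : (fun ω : (Finset (Fin (m + 1)) → ZMod 2) × (Cube (m + 1) → 𝒴) =>
      ω.1 (insert i (lift i A))) = fun ω => (splitSpace i 𝒴 ω).1.1 A +
        (splitSpace i 𝒴 ω).2.1 A := by
    funext ω
    simp [splitSpace, splitBits, ← add_assoc, CharTwo.add_self_eq_zero]
  rw [hX]
  refine bhatt_mono (jointLaw_nonneg W) _ fun ω ω' h => ?_
  simp only [Prod.mk.injEq, observation_eq_iff] at h
  obtain ⟨⟨⟨hy0, hu0⟩, hy1, hu1⟩, -⟩ := h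
  rw [observation_eq_iff]
  refine ⟨(splitWord i 𝒴).injective (Prod.ext hy0 hy1), fun B hB => ?_⟩
  by_cases hi : i ∈ B
  · rw [← insert_lift_drop hi] at hB ⊢
    rw [rmlt_insert_lift] at hB
    have h0 := hu0 _ hB
    have h1 := hu1 _ hB
    simp only [splitSpace, splitBits, Equiv.trans_apply, Equiv.prodCongr_apply,
      Equiv.prodProdProdComm_apply, Prod.map, Equiv.coe_fn_mk] at h0 h1
    rw [h0] at h1
    exact add_left_cancel h1
  · rw [← lift_drop hi] at hB ⊢
    exact hu0 _ (rmlt_of_rmlt_insert_lift hB)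

theorem Zparam_le_sq_insert {A : Finset (Fin m)} {i : Fin m} (hi : i ∉ A) :
    Zparam W A ≤ Zparam W (insert i A) ^ 2 := by
  cases m with
  | zero => exact i.elim0
  | succ m =>
    rw [← lift_drop hi]
    refine (Zparam_lift_le W i _).trans ?_
    exact pow_le_pow_left₀ (Zparam_nonneg W _) (le_Zparam_insert_lift W i _) 2

theorem Zparam_le_insert (A : Finset (Fin m)) (i : Fin m) :
    Zparam W A ≤ Zparam W (insert i A) := by
  by_cases hi : i ∈ A
  · rw [Finset.insert_eq_of_mem hi]
  · have h0 := Zparam_nonneg W (insert i A)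
    have h1 := Zparam_le_one W (insert i A)
    exact (Zparam_le_sq_insert W hi).trans (by nlinarith)

theorem Zparam_mono {A B : Finset (Fin m)} (h : A ⊆ B) : Zparam W A ≤ Zparam W B := by
  suffices ∀ C : Finset (Fin m), Zparam W A ≤ Zparam W (C ∪ A) by
    simpa [Finset.union_eq_left.2 h] using this B
  intro C
  induction C using Finset.induction_on with
  | empty => simp
  | insert i C _ ih =>
    rw [Finset.insert_union]
    exact ih.trans (Zparam_le_insert W _ i)

theorem Zparam_le_sq_of_ssubset {A B : Finset (Fin m)} (h : A ⊂ B) :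
    Zparam W A ≤ Zparam W B ^ 2 := by
  obtain ⟨i, hi, hA⟩ := Finset.ssubset_iff.1 h
  exact (Zparam_le_sq_insert W hi).trans
    (pow_le_pow_left₀ (Zparam_nonneg W _) (Zparam_mono W hA) 2)

end Splitting

/-! ### Conservation of entropy, and capacity at the uniform input -/

section ChainRule

open scoped Classical

variable {m : ℕ} {𝒴 : Type*} [Fintype 𝒴] (W : BMSChannel 𝒴)

/-- The conditional entropy of `U_A` given `Y` and `U_{<A}`, in nats. -/
def bitEnt (A : Finset (Fin m)) : ℝ :=
  condEnt (jointLaw W m) (fun ω => ω.1 A) (observation A)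

/-- The conditional entropy of all the bits given the output, in nats. -/
def bitsEnt (m : ℕ) : ℝ := ent (jointLaw W m) id - ent (jointLaw W m) Prod.snd

theorem sum_bitEnt : ∑ A : Finset (Fin m), bitEnt W A = bitsEnt W m := by
  -- The chain rule is a telescoping sum over initial segments `S` of the order. Bits outside `S`
  -- are masked by `0`, so every stage has the same type.
  have h := sum_insert_sub (RMLT (m := m)) fun S => ent (jointLaw W m)
    fun ω => (ω.2, fun B => if B ∈ S then ω.1 B else 0)
  have h1 : ent (jointLaw W m) (fun ω => (ω.2, fun B => if B ∈ Finset.univ then ω.1 B else 0)) =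
      ent (jointLaw W m) id :=
    ent_congr _ fun ω ω' => by simp [Prod.ext_iff, and_comm, funext_iff]
  have h2 : ent (jointLaw W m) (fun ω => (ω.2, fun B : Finset (Fin m) =>
      if B ∈ (∅ : Finset (Finset (Fin m))) then ω.1 B else 0)) = ent (jointLaw W m) Prod.snd :=
    ent_congr _ fun ω ω' => by simp
  rw [bitsEnt, ← h1, ← h2, ← h]
  refine Finset.sum_congr rfl fun A _ => ?_
  rw [bitEnt, condEnt]
  congr 1
  · refine ent_congr _ fun ω ω' => ?_
    simp only [Prod.mk.injEq (ω.1 A), observation_eq_iff]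
    rw [Prod.mk.injEq, funext_iff (f := fun B => ite _ _ _)]
    constructor
    · rintro ⟨hA, hy, hu⟩
      refine ⟨hy, fun B => ?_⟩
      by_cases hB : B = A
      · simp [hB, hA]
      · by_cases hBA : RMLT B A <;> simp [hB, hBA, hu]
    · rintro ⟨hy, hu⟩
      exact ⟨by simpa using hu A, hy, fun B hB => by simpa [hB] using hu B⟩
  · refine ent_congr _ fun ω ω' => ?_
    rw [observation_eq_iff, Prod.mk.injEq, funext_iff (f := fun B => ite _ _ _)]
    refine and_congr_right fun _ => forall_congr' fun B => ?_
    by_cases hBA : RMLT B A <;> simp [hBA]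

theorem bitEnt_bounds (A : Finset (Fin m)) :
    0 ≤ bitEnt W A ∧ bitEnt W A ≤ Real.log 2 ∧ bitEnt W A ≤ Zparam W A ∧
      Real.log 2 - bitEnt W A ≤ 2 * (1 - Zparam W A) := by
  rw [Zparam_eq_bhatt]
  exact condEnt_bounds (jointLaw_nonneg W) (sum_jointLaw W) _ _

theorem bitsEnt_succ (m : ℕ) : bitsEnt W (m + 1) = 2 * bitsEnt W m := by
  have h1 : ent (jointLaw W (m + 1)) id = 2 * ent (jointLaw W m) id := by
    rw [← ent_prodLaw (jointLaw_nonneg W) (sum_jointLaw W), ← ent_equiv (splitSpace 0 𝒴),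
      ← jointLaw_split W 0]
    refine ent_congr _ fun ω ω' => ?_
    simp only [id]
    exact (splitSpace 0 𝒴).injective.eq_iff.symm
  have h2 : ent (jointLaw W (m + 1)) Prod.snd = 2 * ent (jointLaw W m) Prod.snd := by
    rw [← ent_prodLaw (jointLaw_nonneg W) (sum_jointLaw W), ← ent_equiv (splitSpace 0 𝒴),
      ← jointLaw_split W 0]
    refine ent_congr _ fun ω ω' => ?_
    exact (splitWord 0 𝒴).injective.eq_iff.symm
  rw [bitsEnt, bitsEnt, h1, h2]
  ring

theorem bitsEnt_eq (m : ℕ) : bitsEnt W m = 2 ^ m * bitsEnt W 0 := by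
  induction m with
  | zero => simp
  | succ m ih => rw [bitsEnt_succ, ih]; ring

/-- The sample space of `(U^{(0)}, Y^{(0)})`. -/
def spaceZero (𝒴 : Type*) : (Finset (Fin 0) → ZMod 2) × (Cube 0 → 𝒴) ≃ ZMod 2 × 𝒴 :=
  (Equiv.funUnique _ _).prodCongr (Equiv.funUnique _ _)

theorem jointLaw_zero :
    jointLaw W 0 = fun ω => 1 / 2 * W.prob (spaceZero 𝒴 ω).1 (spaceZero 𝒴 ω).2 := by
  funext ω
  simp only [jointLaw, wordProb, encode_zero, Fintype.prod_unique]
  simp [spaceZero, Equiv.prodCongr_apply]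
  rfl

/-- For a single channel use with uniform input, `H(U | Y) = H(U) - I(U; Y)`; the factor `Real.log
2` converts bits to nats. -/
theorem bitsEnt_zero :
    bitsEnt W 0 = Real.log 2 * (1 - mutualInfo W (1 / 2)) := by
  have hl2 : Real.log 2 ≠ 0 := (Real.log_pos one_lt_two).ne'
  set Q : ZMod 2 × 𝒴 → ℝ := fun ω => 1 / 2 * W.prob ω.1 ω.2 with hQ
  have h1 : ent (jointLaw W 0) id = ent Q id := by
    rw [← ent_equiv (spaceZero 𝒴), jointLaw_zero]
    exact ent_congr _ fun ω ω' => (spaceZero 𝒴).injective.eq_iff.symm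
  have h2 : ent (jointLaw W 0) Prod.snd = ent Q Prod.snd := by
    rw [← ent_equiv (spaceZero 𝒴), jointLaw_zero]
    exact ent_congr _ fun ω ω' => (Equiv.funUnique (Cube 0) 𝒴).injective.eq_iff.symm
  have hq : ∀ y, Pr Q (fun ω => ω.2 = y) = ∑ x', inputDist (1 / 2) x' * W.prob x' y := by
    intro y
    simp only [Pr_eq_sum_ite, Fintype.sum_prod_type, sum_zmod_two, hQ, inputDist]
    simp
    norm_num
  have hsum : ∑ x, ∑ y, 1 / 2 * W.prob x y = 1 := by
    simp only [← Finset.mul_sum, W.sum_eq_one, sum_zmod_two]; norm_num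
  have hmi : Real.log 2 * mutualInfo W (1 / 2) = ∑ x, ∑ y, 1 / 2 * W.prob x y *
      Real.log (W.prob x y / ∑ x', inputDist (1 / 2) x' * W.prob x' y) := by
    rw [mutualInfo, Finset.mul_sum]
    refine Finset.sum_congr rfl fun x _ => ?_
    rw [Finset.mul_sum]
    refine Finset.sum_congr rfl fun y _ => ?_
    have : inputDist (1 / 2) x = 1 / 2 := by unfold inputDist; split_ifs <;> norm_num
    rw [this, Real.logb]
    field_simp
  have hl : Real.log 2 = ∑ x, ∑ y, 1 / 2 * W.prob x y * Real.log 2 := by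
    simp only [← Finset.sum_mul, hsum, one_mul]
  rw [mul_sub, mul_one, hmi, bitsEnt, h1, h2, ent, ent, neg_sub_neg, ← Finset.sum_sub_distrib,
    Fintype.sum_prod_type]
  conv_rhs => rw [hl]
  rw [← Finset.sum_sub_distrib]
  refine Finset.sum_congr rfl fun x _ => ?_
  rw [← Finset.sum_sub_distrib]
  refine Finset.sum_congr rfl fun y _ => ?_
  simp only [id, Pr_eq, hq]
  rcases eq_or_ne (W.prob x y) 0 with h0 | h0
  · simp [hQ, h0]
  have hpos : 0 < W.prob x y := lt_of_le_of_ne (W.nonneg _ _) h0.symm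
  have hr : ∑ x', inputDist (1 / 2) x' * W.prob x' y ≠ 0 := by
    rw [← hq, Pr]
    refine ne_of_gt (lt_of_lt_of_le (mul_pos one_half_pos hpos)
      (Finset.single_le_sum (f := Q) (a := (x, y)) ?_ (by simp)))
    intro ω _
    exact mul_nonneg one_half_pos.le (W.nonneg _ _)
  simp only [hQ]
  rw [Real.log_mul (by norm_num) h0, Real.log_div h0 hr, one_div, Real.log_inv]
  ring

/-- Gibbs' inequality at one output symbol: `w` holds the transition probabilities, `c` the joint
masses, and the true output mass is replaced by that of the uniform input. The final correction sums
to zero over all symbols. -/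
theorem sum_mul_log_div_le {w c : ZMod 2 → ℝ} (hc : ∀ x, 0 ≤ c x) (hw : ∀ x, 0 ≤ w x)
    (hcw : ∀ x, c x ≠ 0 → w x ≠ 0) :
    ∑ x, c x * Real.log (w x / ∑ x', c x') ≤
      ∑ x, c x * Real.log (w x / ∑ x', 1 / 2 * w x') + (∑ x, 1 / 2 * w x - ∑ x, c x) := by
  by_cases h0 : ∀ x, c x = 0
  · simp only [h0, zero_mul, Finset.sum_const_zero, sub_zero, zero_add]
    exact Finset.sum_nonneg fun x _ => mul_nonneg one_half_pos.le (hw x)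
  push Not at h0
  obtain ⟨x₀, hx₀⟩ := h0
  have hr : 0 < ∑ x, c x := Finset.sum_pos' (fun x _ => hc x)
    ⟨x₀, Finset.mem_univ _, lt_of_le_of_ne (hc x₀) hx₀.symm⟩
  have hq : 0 < ∑ x, 1 / 2 * w x :=
    Finset.sum_pos' (fun x _ => mul_nonneg one_half_pos.le (hw x))
      ⟨x₀, Finset.mem_univ _, mul_pos one_half_pos (lt_of_le_of_ne (hw x₀) (hcw x₀ hx₀).symm)⟩
  have key := mul_log_sub_log_le hr.le hq
  have : ∑ x, c x * Real.log (w x / ∑ x', c x') =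
      ∑ x, c x * Real.log (w x / ∑ x', 1 / 2 * w x') +
        (∑ x, c x) * (Real.log (∑ x, 1 / 2 * w x) - Real.log (∑ x, c x)) := by
    rw [Finset.sum_mul, ← Finset.sum_add_distrib]
    refine Finset.sum_congr rfl fun x _ => ?_
    by_cases hx : c x = 0
    · simp [hx]
    rw [Real.log_div (hcw x hx) hr.ne', Real.log_div (hcw x hx) hq.ne']
    ring
  linarith

/-- By symmetry both rows of the channel have the same divergence `D` from the uniform-input output
law. Averaging `D` over any input law gives the mutual information at `1 / 2`, and Gibbs' inequality
bounds the mutual information at `p` by this average. -/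
theorem mutualInfo_le_half {p : ℝ} (hp : p ∈ Set.Icc (0 : ℝ) 1) :
    mutualInfo W p ≤ mutualInfo W (1 / 2) := by
  have hin : ∀ x, inputDist (1 / 2) x = 1 / 2 := fun x => by
    unfold inputDist; split_ifs <;> norm_num
  have hl2 : 0 < Real.log 2 := Real.log_pos one_lt_two
  have hin0 : ∀ x, 0 ≤ inputDist p x := fun x => by
    unfold inputDist; split_ifs <;> linarith [hp.1, hp.2]
  have hin1 : inputDist p 0 + inputDist p 1 = 1 := by simp [inputDist]
  have hmi : ∀ p, mutualInfo W p = (∑ y, ∑ x, inputDist p x * W.prob x y *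
      Real.log (W.prob x y / ∑ x', inputDist p x' * W.prob x' y)) / Real.log 2 := by
    intro p
    rw [mutualInfo, Finset.sum_comm, Finset.sum_div]
    refine Finset.sum_congr rfl fun y _ => ?_
    rw [Finset.sum_div]
    exact Finset.sum_congr rfl fun x _ => (mul_div_assoc _ _ _).symm
  rw [hmi, hmi, div_le_div_iff_of_pos_right hl2]
  simp only [hin]
  set D : ZMod 2 → ℝ := fun x => ∑ y, W.prob x y *
    Real.log (W.prob x y / ∑ x', 1 / 2 * W.prob x' y) with hD
  have hD01 : D 1 = D 0 := by
    obtain ⟨π, hπ, hsymm⟩ := W.symmetric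
    have hsymm' : ∀ y, W.prob 0 y = W.prob 1 (π y) := fun y => by
      rw [hsymm, ← Equiv.Perm.mul_apply]
      nth_rewrite 1 [← hπ]
      simp
    simp only [hD]
    rw [← Equiv.sum_comp π fun y => W.prob 0 y * Real.log (W.prob 0 y / ∑ x', 1 / 2 * W.prob x' y)]
    refine Finset.sum_congr rfl fun y _ => ?_
    simp only [sum_zmod_two, ← hsymm, ← hsymm', add_comm]
  have hmix : ∀ c : ZMod 2 → ℝ, ∑ y, ∑ x, c x * W.prob x y *
      Real.log (W.prob x y / ∑ x', 1 / 2 * W.prob x' y) = (c 0 + c 1) * D 0 := by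
    intro c
    rw [Finset.sum_comm, sum_zmod_two, add_mul]
    rw [show c 1 * D 0 = c 1 * D 1 by rw [hD01]]
    simp only [hD, Finset.mul_sum, mul_assoc]
  have h := Finset.sum_le_sum fun y (_ : y ∈ Finset.univ) => sum_mul_log_div_le
    (w := fun x => W.prob x y) (c := fun x => inputDist p x * W.prob x y)
    (fun x => mul_nonneg (hin0 x) (W.nonneg x y)) (fun x => W.nonneg x y)
    (fun x => right_ne_zero_of_mul)
  rw [Finset.sum_add_distrib, hmix, hin1, Finset.sum_sub_distrib] at h
  rw [hmix fun _ => 1 / 2]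
  have e1 : ∑ y, ∑ x, 1 / 2 * W.prob x y = 1 := by
    rw [Finset.sum_comm]
    simp only [← Finset.mul_sum, W.sum_eq_one, sum_zmod_two]; norm_num
  have e2 : ∑ y, ∑ x, inputDist p x * W.prob x y = 1 := by
    rw [Finset.sum_comm]
    simp only [← Finset.mul_sum, W.sum_eq_one, sum_zmod_two, mul_one, hin1]
  rw [e1, e2] at h
  linarith

theorem capacity_eq : capacity W = mutualInfo W (1 / 2) := by
  refine IsGreatest.csSup_eq ⟨⟨1 / 2, by norm_num, rfl⟩, ?_⟩
  rintro _ ⟨p, hp, rfl⟩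
  exact mutualInfo_le_half W hp

theorem sum_log_two_sub_bitEnt :
    ∑ A : Finset (Fin m), (Real.log 2 - bitEnt W A) = 2 ^ m * (Real.log 2 * capacity W) := by
  rw [Finset.sum_sub_distrib, sum_bitEnt, bitsEnt_eq, bitsEnt_zero, capacity_eq]
  simp
  ring

end ChainRule

/-! ### Error analysis of the successive decoder, and the size of the code -/

section Decoding

open scoped Classical

/-- The probability that the likelihood of a bit does not exceed that of its complement is at most
the Bhattacharyya parameter. -/
theorem Pr_likelihood_le_bhatt {Ω β : Type*} [Fintype Ω] [Fintype β] {P : Ω → ℝ}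
    (hP : ∀ ω, 0 ≤ P ω) (X : Ω → ZMod 2) (V : Ω → β) :
    Pr P (fun ω => Pr P (fun ω' => X ω' = X ω ∧ V ω' = V ω) ≤
      Pr P (fun ω' => X ω' = X ω + 1 ∧ V ω' = V ω)) ≤ bhatt P X V := by
  have key : ∀ x v, Pr P (fun ω => Pr P (fun ω' => X ω' = X ω ∧ V ω' = V ω) ≤
      Pr P (fun ω' => X ω' = X ω + 1 ∧ V ω' = V ω) ∧ (X ω, V ω) = (x, v)) ≤
      √(Pr P (fun ω => X ω = x ∧ V ω = v) * Pr P (fun ω => X ω = x + 1 ∧ V ω = v)) := by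
    intro x v
    by_cases h : Pr P (fun ω => X ω = x ∧ V ω = v) ≤ Pr P (fun ω => X ω = x + 1 ∧ V ω = v)
    -- The mass in error is the smaller of two masses, hence at most their geometric mean.
    · have h1 : Pr P (fun ω => X ω = x ∧ V ω = v) ≤
          √(Pr P (fun ω => X ω = x ∧ V ω = v) * Pr P (fun ω => X ω = x + 1 ∧ V ω = v)) :=
        Real.le_sqrt_of_sq_le (by rw [sq]; exact mul_le_mul_of_nonneg_left h (Pr_nonneg hP _))
      refine le_trans ?_ h1
      refine Finset.sum_le_sum_of_subset_of_nonneg (fun ω => ?_) fun ω _ _ => hP ω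
      simp
    · refine le_trans (le_of_eq ?_) (Real.sqrt_nonneg _)
      rw [Pr_eq_sum_ite]
      refine Finset.sum_eq_zero fun ω _ => if_neg ?_
      rintro ⟨h1, h2⟩
      obtain ⟨rfl, rfl⟩ := Prod.mk.inj h2
      exact h h1
  rw [← sum_Pr_and P _ fun ω => (X ω, V ω)]
  refine (Finset.sum_le_sum fun xv _ => key xv.1 xv.2).trans (le_of_eq ?_)
  rw [Fintype.sum_prod_type, sum_zmod_two, bhatt, two_mul]
  simp only [zero_add, show (1 : ZMod 2) + 1 = 0 by decide]
  congr 1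
  exact Finset.sum_congr rfl fun v _ => by rw [mul_comm]

variable {m : ℕ} {𝒴 : Type*}

/-- Application of a permutation of the alphabet at the coordinates where `c` is nonzero. -/
def translate (π : Equiv.Perm 𝒴) (c : Cube m → ZMod 2) : (Cube m → 𝒴) ≃ (Cube m → 𝒴) :=
  Equiv.piCongrRight fun z => if c z = 0 then Equiv.refl 𝒴 else π

theorem encode_add (u v : Finset (Fin m) → ZMod 2) : encode (u + v) = encode u + encode v := by
  simp [encode, add_smul, Finset.sum_add_distrib]

variable [Fintype 𝒴] (W : BMSChannel 𝒴)

/-- A permutation of the output alphabet that exchanges the two inputs. -/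
theorem exists_perm_prob_add :
    ∃ π : Equiv.Perm 𝒴, ∀ x y, W.prob (x + 1) (π y) = W.prob x y := by
  obtain ⟨π, hπ, hsymm⟩ := W.symmetric
  refine ⟨π, fun x y => ?_⟩
  rcases zmod_two_cases x with rfl | rfl
  · rw [zero_add, hsymm, ← Equiv.Perm.mul_apply]
    nth_rewrite 1 [← hπ]
    simp
  · rw [hsymm]; rfl

theorem wordProb_translate {π : Equiv.Perm 𝒴} (hπ : ∀ x y, W.prob (x + 1) (π y) = W.prob x y)
    (x c : Cube m → ZMod 2) (y : Cube m → 𝒴) :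
    wordProb W (x + c) (translate π c y) = wordProb W x y := by
  refine Finset.prod_congr rfl fun z _ => ?_
  rcases zmod_two_cases (c z) with h | h
  · simp [translate, h]
  · simp [translate, h, hπ]

/-- Adding `v` to the bits while permuting outputs along `encode v` preserves the joint law. -/
theorem bitLikelihood_translate {π : Equiv.Perm 𝒴}
    (hπ : ∀ x y, W.prob (x + 1) (π y) = W.prob x y) (A : Finset (Fin m)) (y : Cube m → 𝒴)
    (u v : Finset (Fin m) → ZMod 2) (a : ZMod 2) :
    bitLikelihood W A (translate π (encode v) y) (past A (u + v)) (a + v A) =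
      bitLikelihood W A y (past A u) a := by
  rw [bitLikelihood, ← Pr_equiv ((Equiv.addRight v).prodCongr (translate π (encode v))),
    bitLikelihood]
  have hP : (fun ω => jointLaw W m (((Equiv.addRight v).prodCongr (translate π (encode v))) ω)) =
      jointLaw W m := by
    funext ω
    simp [jointLaw, encode_add, wordProb_translate W hπ]
  rw [hP]
  refine Pr_congr fun ω => ?_
  simp [past, funext_iff]

/-- The event that the likelihood of the transmitted bit, given the true past, does not exceed that
of its complement. -/
def BitError (A : Finset (Fin m)) (u : Finset (Fin m) → ZMod 2) (y : Cube m → 𝒴) : Prop :=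
  bitLikelihood W A y (past A u) (u A) ≤ bitLikelihood W A y (past A u) (u A + 1)

/-- The probability of `BitError` given the transmitted bits. -/
def bitErrorProb (A : Finset (Fin m)) (u : Finset (Fin m) → ZMod 2) : ℝ :=
  ∑ y with BitError W A u y, wordProb W (encode u) y

/-- Channel symmetry moves every transmitted word to the zero word. So a bound averaged over random
bits holds for each fixed word, in particular for words with frozen zeros. -/
theorem bitErrorProb_eq_zero (A : Finset (Fin m)) (u : Finset (Fin m) → ZMod 2) :
    bitErrorProb W A u = bitErrorProb W A 0 := by
  obtain ⟨π, hπ⟩ := exists_perm_prob_add W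
  rw [bitErrorProb, bitErrorProb, Finset.sum_filter, Finset.sum_filter,
    ← (translate π (encode u)).sum_comp]
  refine Finset.sum_congr rfl fun y _ => ?_
  have h1 : BitError W A u (translate π (encode u) y) ↔ BitError W A 0 y := by
    have h := fun a => bitLikelihood_translate W hπ A y 0 u a
    have h0 := h 0
    have h1 := h 1
    rw [zero_add] at h0 h1
    rw [zero_add] at h0
    rw [add_comm] at h1
    simp only [BitError, h0, h1, Pi.zero_apply, zero_add]
  have h2 := wordProb_translate W hπ 0 (encode u) y
  rw [zero_add] at h2
  have h3 : encode (0 : Finset (Fin m) → ZMod 2) = 0 := by simp [encode]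
  simp only [h1, h2, h3]

theorem bitErrorProb_le (A : Finset (Fin m)) (u : Finset (Fin m) → ZMod 2) :
    bitErrorProb W A u ≤ Zparam W A := by
  have h := Pr_likelihood_le_bhatt (jointLaw_nonneg W (m := m)) (fun ω => ω.1 A) (observation A)
  rw [← Zparam_eq_bhatt] at h
  refine le_trans (le_of_eq ?_) h
  have : ∀ ω : (Finset (Fin m) → ZMod 2) × (Cube m → 𝒴),
      (Pr (jointLaw W m) (fun ω' => ω'.1 A = ω.1 A ∧ observation A ω' = observation A ω) ≤
        Pr (jointLaw W m) (fun ω' => ω'.1 A = ω.1 A + 1 ∧ observation A ω' = observation A ω)) ↔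
      BitError W A ω.1 ω.2 := fun ω => Iff.rfl
  rw [Pr_congr this, Pr_eq_sum_ite, Fintype.sum_prod_type]
  have h2 : ∀ v : Finset (Fin m) → ZMod 2,
      (∑ y, if BitError W A v y then jointLaw W m (v, y) else 0) =
        (1 / 2) ^ (2 ^ m) * bitErrorProb W A u := by
    intro v
    rw [bitErrorProb_eq_zero W A u, ← bitErrorProb_eq_zero W A v, bitErrorProb, Finset.sum_filter,
      Finset.mul_sum]
    simp [jointLaw]
  simp only [h2]
  rw [Finset.sum_const, Finset.card_univ, card_bits]
  simp

theorem successiveDecoder_eq (G : Finset (Finset (Fin m)))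
    (tie : (Cube m → 𝒴) → Finset (Fin m) → ZMod 2) (y : Cube m → 𝒴) (A : Finset (Fin m)) :
    successiveDecoder W G tie y A = if A ∈ G then
      mapDecision (bitLikelihood W A y (past A (successiveDecoder W G tie y))) (tie y A) else 0 := by
  rw [successiveDecoder, WellFounded.fix_eq]
  rfl

theorem le_of_mapDecision_ne {L : ZMod 2 → ℝ} {t a : ZMod 2} (h : mapDecision L t ≠ a) :
    L a ≤ L (a + 1) := by
  unfold mapDecision at h
  rcases zmod_two_cases a with rfl | rfl
  · rw [zero_add]
    by_contra! h'
    simp [h'] at h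
  · rw [show (1 : ZMod 2) + 1 = 0 by decide]
    by_contra! h'
    simp [h', h'.not_gt] at h

/-- At the first wrong index the decoder has used the true past. Frozen indices are never wrong, so
this index lies in `G`, and a wrong maximum-likelihood choice, tie or not, is a `BitError`. -/
theorem exists_bitError (G : Finset (Finset (Fin m)))
    (tie : (Cube m → 𝒴) → Finset (Fin m) → ZMod 2) (y : Cube m → 𝒴)
    {u : Finset (Fin m) → ZMod 2} (hu : ∀ A, A ∉ G → u A = 0)
    (h : successiveDecoder W G tie y ≠ u) : ∃ A ∈ G, BitError W A u y := by
  obtain ⟨A, hA, hmin⟩ := (rmlt_wellFounded m).has_min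
    {A | successiveDecoder W G tie y A ≠ u A} (Function.ne_iff.1 h)
  have hpast : past A (successiveDecoder W G tie y) = past A u := by
    funext B
    by_contra hB
    exact hmin B.1 hB B.2
  rw [Set.mem_ofPred_eq, successiveDecoder_eq, hpast] at hA
  by_cases hG : A ∈ G
  · rw [if_pos hG] at hA
    exact ⟨A, hG, le_of_mapDecision_ne hA⟩
  · rw [if_neg hG, hu A hG] at hA
    exact absurd rfl hA

theorem card_messages (G : Finset (Finset (Fin m))) :
    ({u | ∀ A, A ∉ G → u A = 0} : Finset (Finset (Fin m) → ZMod 2)).card = 2 ^ G.card := by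
  have : ({u | ∀ A, A ∉ G → u A = 0} : Finset (Finset (Fin m) → ZMod 2)) =
      Fintype.piFinset fun A => if A ∈ G then Finset.univ else {0} := by
    ext u
    simp only [Finset.mem_filter, Finset.mem_univ, true_and, Fintype.mem_piFinset]
    refine forall_congr' fun A => ?_
    by_cases h : A ∈ G <;> simp [h]
  rw [this, Fintype.card_piFinset]
  simp only [apply_ite Finset.card, Finset.card_univ, ZMod.card, Finset.card_singleton]
  rw [Finset.prod_ite_mem, Finset.univ_inter, Finset.prod_const]

theorem blockError_nonneg (G : Finset (Finset (Fin m)))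
    (tie : (Cube m → 𝒴) → Finset (Fin m) → ZMod 2) : 0 ≤ blockError W G tie :=
  mul_nonneg (by positivity)
    (Finset.sum_nonneg fun _ _ => Finset.sum_nonneg fun _ _ => wordProb_nonneg W _ _)

theorem blockError_le (G : Finset (Finset (Fin m)))
    (tie : (Cube m → 𝒴) → Finset (Fin m) → ZMod 2) :
    blockError W G tie ≤ ∑ A ∈ G, Zparam W A := by
  have key : ∀ u ∈ ({u | ∀ A, A ∉ G → u A = 0} : Finset (Finset (Fin m) → ZMod 2)),
      ∑ y with successiveDecoder W G tie y ≠ u, wordProb W (encode u) y ≤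
        ∑ A ∈ G, Zparam W A := by
    intro u hu
    have hu' : ∀ A, A ∉ G → u A = 0 := by simpa using hu
    refine le_trans ?_ (Finset.sum_le_sum fun A _ => bitErrorProb_le W A u)
    simp only [bitErrorProb, Finset.sum_filter]
    rw [Finset.sum_comm]
    refine Finset.sum_le_sum fun y _ => ?_
    have hnn : ∀ A ∈ G, 0 ≤ if BitError W A u y then wordProb W (encode u) y else 0 :=
      fun A _ => by split_ifs; exacts [wordProb_nonneg W _ _, le_rfl]
    split_ifs with h
    · obtain ⟨A, hA, hE⟩ := exists_bitError W G tie y hu' h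
      have := Finset.single_le_sum hnn hA
      rwa [if_pos hE] at this
    · exact Finset.sum_nonneg hnn
  have h := Finset.sum_le_sum key
  rw [Finset.sum_const, card_messages, nsmul_eq_mul] at h
  have h2 := mul_le_mul_of_nonneg_left h (by positivity : (0 : ℝ) ≤ (1 / 2) ^ G.card)
  rw [← mul_assoc] at h2
  rw [blockError]
  convert h2 using 1
  · congr!
  · push_cast
    rw [← mul_pow]
    norm_num

theorem ncard_twinCode (m : ℕ) (δ : ℝ) :
    (twinCode W m δ).ncard = 2 ^ (goodSets W m δ).card := by
  have : twinCode W m δ = encode '' (({u | ∀ A, A ∉ goodSets W m δ → u A = 0} :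
      Finset (Finset (Fin m) → ZMod 2)) : Set (Finset (Fin m) → ZMod 2)) := by
    ext c
    simp only [twinCode, Set.mem_ofPred_eq, Set.mem_image, Finset.coe_filter, Finset.mem_univ,
      true_and]
    constructor
    · rintro ⟨u, rfl⟩
      refine ⟨fun A => if A ∈ goodSets W m δ then u A else 0, fun A hA => if_neg hA, ?_⟩
      simp [encode, ite_smul, Finset.sum_ite_mem]
    · rintro ⟨u, hu, rfl⟩
      refine ⟨u, (Finset.sum_subset (Finset.subset_univ _) fun A _ hA => ?_).symm⟩
      rw [hu A hA, zero_smul]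
  rw [this, Set.ncard_image_of_injective _ (encode_injective m), Set.ncard_coe_finset,
    card_messages]

theorem rate_twinCode (m : ℕ) (δ : ℝ) :
    rate (twinCode W m δ) = (goodSets W m δ).card / 2 ^ m := by
  rw [rate, ncard_twinCode]
  push_cast
  rw [Real.logb_pow, Real.logb_self_eq_one one_lt_two, mul_one]

end Decoding

/-! ### Sperner's theorem and the asymptotic estimates -/

section Polarization

open scoped Classical

variable {α : Type*} [Fintype α]

/-- Two nested sets cannot both lie in the layer, since the smaller would have value at most `c ^
2`. So the layer is an antichain. -/
theorem card_Ioc_sq_le_choose {Z : Finset α → ℝ} (h0 : ∀ A, 0 ≤ Z A)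
    (h : ∀ A B, A ⊂ B → Z A ≤ Z B ^ 2) (c : ℝ) :
    ({A | c ^ 2 < Z A ∧ Z A ≤ c} : Finset (Finset α)).card ≤
      (Fintype.card α).choose (Fintype.card α / 2) := by
  refine IsAntichain.sperner fun A hA B hB hne hAB => ?_
  simp only [Finset.coe_filter, Finset.mem_univ, true_and, Set.mem_ofPred_eq] at hA hB
  have := h A B (hAB.ssubset_of_ne hne)
  exact absurd (this.trans (pow_le_pow_left₀ (h0 B) hB.2 2)) (not_le.2 hA.1)

/-- A family of numbers indexed by sets that is at least squared when the set shrinks has few values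
between `c ^ 2 ^ J` and `c`. -/
theorem card_Ioc_pow_le {Z : Finset α → ℝ} (h0 : ∀ A, 0 ≤ Z A)
    (h : ∀ A B, A ⊂ B → Z A ≤ Z B ^ 2) (c : ℝ) (J : ℕ) :
    ({A | c ^ 2 ^ J < Z A ∧ Z A ≤ c} : Finset (Finset α)).card ≤
      J * (Fintype.card α).choose (Fintype.card α / 2) := by
  induction J with
  | zero =>
    rw [Finset.filter_false_of_mem, Finset.card_empty]
    · simp
    · intro A _ hA
      rw [pow_zero, pow_one] at hA
      exact absurd hA.2 (not_le.2 hA.1)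
  | succ J ih =>
    have hsub : ({A | c ^ 2 ^ (J + 1) < Z A ∧ Z A ≤ c} : Finset (Finset α)) ⊆
        ({A | c ^ 2 ^ J < Z A ∧ Z A ≤ c} : Finset (Finset α)) ∪
          ({A | (c ^ 2 ^ J) ^ 2 < Z A ∧ Z A ≤ c ^ 2 ^ J} : Finset (Finset α)) := by
      intro A
      simp only [Finset.mem_filter, Finset.mem_univ, true_and, Finset.mem_union, ← pow_mul,
        ← pow_succ]
      rintro ⟨h1, h2⟩
      rcases le_or_gt (Z A) (c ^ 2 ^ J) with h3 | h3
      · exact Or.inr ⟨h1, h3⟩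
      · exact Or.inl ⟨h3, h2⟩
    calc _ ≤ _ := Finset.card_le_card hsub
      _ ≤ _ := Finset.card_union_le _ _
      _ ≤ J * (Fintype.card α).choose (Fintype.card α / 2) +
          (Fintype.card α).choose (Fintype.card α / 2) :=
        add_le_add ih (card_Ioc_sq_le_choose h0 h _)
      _ = _ := by ring

theorem centralBinom_sq_mul_le (n : ℕ) : n.centralBinom ^ 2 * (2 * n + 1) ≤ 16 ^ n := by
  induction n with
  | zero => simp
  | succ n ih =>
    have h := Nat.succ_mul_centralBinom_succ n
    refine le_of_mul_le_mul_left ?_ (show 0 < (n + 1) ^ 2 by positivity)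
    calc (n + 1) ^ 2 * ((n + 1).centralBinom ^ 2 * (2 * (n + 1) + 1))
        = ((n + 1) * (n + 1).centralBinom) ^ 2 * (2 * n + 3) := by ring
      _ = (n.centralBinom ^ 2 * (2 * n + 1)) * (4 * ((2 * n + 1) * (2 * n + 3))) := by
        rw [h]; ring
      _ ≤ 16 ^ n * (4 * (4 * (n + 1) ^ 2)) := by
        refine Nat.mul_le_mul ih (Nat.mul_le_mul_left _ ?_)
        -- `(2n + 1)(2n + 3) = 4(n + 1)² - 1`.
        nlinarith
      _ = (n + 1) ^ 2 * 16 ^ (n + 1) := by ring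

theorem choose_middle_sq_mul_le (m : ℕ) : (m.choose (m / 2)) ^ 2 * (m + 1) ≤ (2 ^ m) ^ 2 := by
  obtain ⟨n, rfl | rfl⟩ := Nat.even_or_odd' m
  · have h := centralBinom_sq_mul_le n
    rw [Nat.centralBinom_eq_two_mul_choose] at h
    rw [Nat.mul_div_cancel_left n two_pos]
    refine h.trans (le_of_eq ?_)
    rw [← pow_mul, mul_right_comm, pow_mul]
    norm_num
  -- For odd `m = 2n + 1` the middle coefficient is half of the next central one.
  · have h := centralBinom_sq_mul_le (n + 1)
    have h2 : (n + 1).centralBinom = 2 * (2 * n + 1).choose n := by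
      rw [Nat.centralBinom_eq_two_mul_choose, show 2 * (n + 1) = 2 * n + 1 + 1 by ring,
        Nat.choose_succ_succ, Nat.choose_symm_half]
      ring
    rw [h2] at h
    rw [show (2 * n + 1) / 2 = n by omega]
    have h3 : (16 : ℕ) ^ (n + 1) = 4 * (2 ^ (2 * n + 1)) ^ 2 := by
      rw [pow_succ, pow_succ 2, pow_mul, mul_pow, ← pow_mul, mul_comm n 2, pow_mul]
      norm_num
      ring
    rw [h3] at h
    nlinarith

theorem choose_middle_div_le (m : ℕ) : (m.choose (m / 2) : ℝ) / 2 ^ m ≤ 1 / √(m + 1) := by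
  have h : ((m.choose (m / 2) : ℝ)) ^ 2 * (m + 1) ≤ (2 ^ m) ^ 2 := by
    exact_mod_cast choose_middle_sq_mul_le m
  rw [div_le_div_iff₀ (by positivity) (Real.sqrt_pos.2 (by positivity)), one_mul]
  refine le_of_sq_le_sq ?_ (by positivity)
  rwa [mul_pow, Real.sq_sqrt (by positivity)]

theorem tendsto_log_div_sqrt :
    Tendsto (fun m : ℕ => ((2 * (Nat.log 2 m + 1) : ℕ) : ℝ) / √(m + 1)) atTop (𝓝 0) := by
  have hl2 : 0 < Real.log 2 := Real.log_pos one_lt_two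
  have hlog : Tendsto (fun m : ℕ => Real.log m / √m) atTop (𝓝 0) := by
    have := (isLittleO_log_rpow_atTop (r := 1 / 2) (by norm_num)).tendsto_div_nhds_zero
    simp only [← Real.sqrt_eq_rpow] at this
    exact this.comp tendsto_natCast_atTop_atTop
  have hone : Tendsto (fun m : ℕ => 1 / √(m : ℝ)) atTop (𝓝 0) :=
    tendsto_const_nhds.div_atTop (Real.tendsto_sqrt_atTop.comp tendsto_natCast_atTop_atTop)
  have hlim := (hlog.const_mul (2 / Real.log 2)).add (hone.const_mul 2)
  simp only [mul_zero, add_zero] at hlim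
  refine squeeze_zero' (Eventually.of_forall fun m => by positivity) ?_ hlim
  filter_upwards [eventually_ge_atTop 1] with m hm
  have hm' : (0 : ℝ) < m := by exact_mod_cast hm
  have h1 : ((2 * (Nat.log 2 m + 1) : ℕ) : ℝ) ≤ 2 * (Real.log m / Real.log 2 + 1) := by
    have := Real.natLog_le_logb m 2
    rw [Real.logb] at this
    push_cast at this ⊢
    linarith
  have h2 : √(m : ℝ) ≤ √(m + 1) := Real.sqrt_le_sqrt (by linarith)
  have h3 : 0 < √(m : ℝ) := Real.sqrt_pos.2 hm'
  calc _ ≤ ((2 * (Nat.log 2 m + 1) : ℕ) : ℝ) / √m :=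
        div_le_div_of_nonneg_left (by positivity) h3 h2
    _ ≤ 2 * (Real.log m / Real.log 2 + 1) / √m := div_le_div_of_nonneg_right h1 h3.le
    _ = _ := by ring

/-- With `2 (Nat.log 2 m + 1)` squarings the exponent is at least `m²`, and `c ^ (m * m) = (c ^ m) ^
m` beats `2 ^ (-d m)`. By `tendsto_log_div_sqrt` this number of layers is still negligible against
`√m`. -/
theorem eventually_pow_lt_rpow {c : ℝ} (hc : 0 ≤ c) (hc1 : c < 1) (d : ℝ) :
    ∀ᶠ m : ℕ in atTop, c ^ 2 ^ (2 * (Nat.log 2 m + 1)) < ((2 ^ m : ℕ) : ℝ) ^ (-d) := by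
  have hpos : (0 : ℝ) < 2 ^ (-d) := by positivity
  filter_upwards [(tendsto_pow_atTop_nhds_zero_of_lt_one hc hc1).eventually_lt_const hpos,
    eventually_ge_atTop 1] with m hm hm1
  have h1 : m * m ≤ 2 ^ (2 * (Nat.log 2 m + 1)) := by
    have := (Nat.lt_pow_succ_log_self one_lt_two m).le
    rw [two_mul, pow_add]
    exact Nat.mul_le_mul this this
  calc c ^ 2 ^ (2 * (Nat.log 2 m + 1)) ≤ c ^ (m * m) := pow_le_pow_of_le_one hc hc1.le h1
    _ = (c ^ m) ^ m := pow_mul _ _ _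
    _ < ((2 : ℝ) ^ (-d)) ^ m := pow_lt_pow_left₀ hm (by positivity) (by omega)
    _ = ((2 ^ m : ℕ) : ℝ) ^ (-d) := by
      push_cast
      rw [← Real.rpow_natCast, ← Real.rpow_natCast, ← Real.rpow_mul two_pos.le,
        ← Real.rpow_mul two_pos.le, mul_comm]

end Polarization

/-! ### Limits of the rate and of the block error -/

section Capacity

open scoped Classical

variable {m : ℕ} {𝒴 : Type*} [Fintype 𝒴] (W : BMSChannel 𝒴)

theorem mem_goodSets {δ : ℝ} {A : Finset (Fin m)} : A ∈ goodSets W m δ ↔ Zparam W A < δ := by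
  simp [goodSets]

theorem card_finset_cast (m : ℕ) : ((Finset.univ : Finset (Finset (Fin m))).card : ℝ) = 2 ^ m := by
  simp

theorem card_goodSets_le (m : ℕ) (δ : ℝ) : ((goodSets W m δ).card : ℝ) ≤ 2 ^ m := by
  rw [← card_finset_cast]
  exact_mod_cast Finset.card_le_card (Finset.subset_univ _)

/-- Each good set has deficit `log 2 - bitEnt` at least `log 2 - |δ|`, the other deficits are
nonnegative, and the total is fixed. -/
theorem rate_twinCode_le (m : ℕ) (δ : ℝ) :
    rate (twinCode W m δ) ≤ capacity W + |δ| / Real.log 2 := by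
  have hl2 : 0 < Real.log 2 := Real.log_pos one_lt_two
  have hn : (0 : ℝ) < 2 ^ m := by positivity
  have h1 : ((goodSets W m δ).card : ℝ) * (Real.log 2 - |δ|) ≤
      2 ^ m * (Real.log 2 * capacity W) := by
    rw [← sum_log_two_sub_bitEnt, ← nsmul_eq_mul, ← Finset.sum_const]
    refine (Finset.sum_le_sum fun A hA => ?_).trans (Finset.sum_le_sum_of_subset_of_nonneg
      (Finset.subset_univ _) fun A _ _ => sub_nonneg.2 (bitEnt_bounds W A).2.1)
    have := (bitEnt_bounds W A).2.2.1
    have := (mem_goodSets W).1 hA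
    linarith [le_abs_self δ]
  have h2 := mul_le_mul_of_nonneg_right (card_goodSets_le W m δ) (abs_nonneg δ)
  rw [rate_twinCode, div_le_iff₀ hn]
  refine le_of_mul_le_mul_right ?_ hl2
  have : (capacity W + |δ| / Real.log 2) * 2 ^ m * Real.log 2 =
      2 ^ m * (Real.log 2 * capacity W) + 2 ^ m * |δ| := by field_simp
  linarith

/-- The total deficit is charged to three classes: good sets and intermediate sets cost at most `log
2` each, while any remaining set has `Zparam` above `c` and costs at most `2 (1 - c)`. -/
theorem capacity_le (m J : ℕ) {δ c : ℝ} (hδ : c ^ 2 ^ J < δ) (hc : c ≤ 1) :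
    capacity W ≤ rate (twinCode W m δ) + J / √(m + 1) + 2 * (1 - c) / Real.log 2 := by
  have hl2 : 0 < Real.log 2 := Real.log_pos one_lt_two
  have hn : (0 : ℝ) < 2 ^ m := by positivity
  set mid : Finset (Finset (Fin m)) := {A | c ^ 2 ^ J < Zparam W A ∧ Zparam W A ≤ c} with hmid
  have hpt : ∀ A : Finset (Fin m), Real.log 2 - bitEnt W A ≤
      (if A ∈ goodSets W m δ then Real.log 2 else 0) + (if A ∈ mid then Real.log 2 else 0) +
        2 * (1 - c) := by
    intro A
    obtain ⟨h1, -, -, h2⟩ := bitEnt_bounds W A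
    by_cases hG : A ∈ goodSets W m δ
    · rw [if_pos hG]
      split_ifs <;> linarith
    · rw [if_neg hG]
      rw [mem_goodSets, not_lt] at hG
      by_cases hA : A ∈ mid
      · rw [if_pos hA]; linarith
      · rw [if_neg hA]
        have : c < Zparam W A := by
          by_contra! h
          exact hA (by simp only [hmid, Finset.mem_filter, Finset.mem_univ, true_and]
                       exact ⟨hδ.trans_le hG, h⟩)
        linarith
  have hsum := Finset.sum_le_sum fun A (_ : A ∈ Finset.univ) => hpt A
  rw [sum_log_two_sub_bitEnt, Finset.sum_add_distrib, Finset.sum_add_distrib,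
    Finset.sum_ite_mem, Finset.sum_ite_mem, Finset.univ_inter, Finset.univ_inter,
    Finset.sum_const, Finset.sum_const, Finset.sum_const, nsmul_eq_mul, nsmul_eq_mul, nsmul_eq_mul,
    card_finset_cast] at hsum
  have hcard : (mid.card : ℝ) ≤ J * m.choose (m / 2) := by
    have := card_Ioc_pow_le (Zparam_nonneg W) (fun A B => Zparam_le_sq_of_ssubset W (m := m)) c J
    rw [Fintype.card_fin] at this
    exact_mod_cast this
  have hcard2 : (mid.card : ℝ) / 2 ^ m ≤ J / √(m + 1) := by
    calc (mid.card : ℝ) / 2 ^ m ≤ J * m.choose (m / 2) / 2 ^ m :=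
          div_le_div_of_nonneg_right hcard hn.le
      _ = J * (m.choose (m / 2) / 2 ^ m) := mul_div_assoc _ _ _
      _ ≤ J * (1 / √(m + 1)) := mul_le_mul_of_nonneg_left (choose_middle_div_le m) (by positivity)
      _ = J / √(m + 1) := by ring
  rw [rate_twinCode]
  have hle : capacity W ≤
      (goodSets W m δ).card / 2 ^ m + mid.card / 2 ^ m + 2 * (1 - c) / Real.log 2 := by
    have : (goodSets W m δ).card / 2 ^ m + mid.card / 2 ^ m + 2 * (1 - c) / Real.log 2 =
        ((goodSets W m δ).card * Real.log 2 + mid.card * Real.log 2 + 2 ^ m * (2 * (1 - c))) /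
          (2 ^ m * Real.log 2) := by field_simp
    rw [this, le_div_iff₀ (by positivity)]
    linarith
  linarith

theorem tendsto_rate_twinCode {δ : ℕ → ℝ} {d : ℝ}
    (hpoly : ∀ᶠ n : ℕ in atTop, (n : ℝ) ^ (-d) ≤ δ n) (hδ : Tendsto δ atTop (𝓝 0)) :
    Tendsto (fun m : ℕ => rate (twinCode W m (δ (2 ^ m)))) atTop (𝓝 (capacity W)) := by
  have hl2 : 0 < Real.log 2 := Real.log_pos one_lt_two
  have htwo : Tendsto (fun m : ℕ => 2 ^ m) atTop atTop :=
    tendsto_pow_atTop_atTop_of_one_lt one_lt_two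
  refine tendsto_order.2 ⟨fun a ha => ?_, fun a ha => ?_⟩
  -- The cutoff is `c = 1 - ε`. This `ε` makes the loss from sets above `c` at most half of the gap
  -- `capacity W - a`, leaving the other half for the intermediate sets; the cap `1 / 2` keeps `c`
  -- positive.
  · set ε := min (1 / 2) ((capacity W - a) * Real.log 2 / 4) with hε
    have hε0 : 0 < ε := lt_min (by norm_num)
      (div_pos (mul_pos (sub_pos.2 ha) hl2) (by norm_num))
    have hε1 : ε ≤ 1 / 2 := min_le_left _ _
    have hε2 : 2 * ε / Real.log 2 ≤ (capacity W - a) / 2 := by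
      rw [div_le_iff₀ hl2]
      linarith [min_le_right (1 / 2) ((capacity W - a) * Real.log 2 / 4)]
    filter_upwards [htwo.eventually hpoly,
      eventually_pow_lt_rpow (c := 1 - ε) (by linarith) (by linarith) d,
      tendsto_log_div_sqrt.eventually_lt_const (half_pos (sub_pos.2 ha))] with m h1 h2 h3
    have := capacity_le W m _ (h2.trans_le h1) (by linarith)
    rw [sub_sub_cancel] at this
    linarith
  · have hlim : Tendsto (fun m : ℕ => capacity W + |δ (2 ^ m)| / Real.log 2) atTop
        (𝓝 (capacity W)) := by
      simpa using (((hδ.comp htwo).abs).div_const (Real.log 2)).const_add (capacity W)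
    filter_upwards [hlim.eventually_lt_const ha] with m hm
    exact (rate_twinCode_le W m _).trans_lt hm

theorem tendsto_blockError {δ : ℕ → ℝ} (hδ : Tendsto (fun n : ℕ => n * δ n) atTop (𝓝 0))
    (tie : (m : ℕ) → (Cube m → 𝒴) → Finset (Fin m) → ZMod 2) :
    Tendsto (fun m : ℕ => blockError W (goodSets W m (δ (2 ^ m))) (tie m)) atTop (𝓝 0) := by
  have hlim := (hδ.comp (tendsto_pow_atTop_atTop_of_one_lt (r := 2) one_lt_two)).abs
  rw [abs_zero] at hlim
  refine squeeze_zero (fun m => blockError_nonneg W _ _) (fun m => ?_) hlim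
  refine (blockError_le W _ _).trans ?_
  refine (Finset.sum_le_sum fun A hA => (((mem_goodSets W).1 hA).le.trans (le_abs_self _))).trans ?_
  rw [Finset.sum_const, nsmul_eq_mul, Function.comp_apply, abs_mul]
  refine mul_le_mul_of_nonneg_right ?_ (abs_nonneg _)
  simpa using card_goodSets_le W m _

end Capacity

end

end TwinCode

theorem mainTheorem2 {𝒴 : Type*} [Fintype 𝒴] (W : TwinCode.BMSChannel 𝒴) (δ : ℕ → ℝ)
    (hpoly : ∃ d : ℝ, ∀ᶠ n : ℕ in atTop, (n : ℝ) ^ (-d) ≤ δ n)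
    (hsmall : δ =o[atTop] fun n : ℕ => (n : ℝ) ^ (-2 : ℝ)) :
    Tendsto (fun m : ℕ => TwinCode.rate (TwinCode.twinCode W m (δ (2 ^ m)))) atTop
      (𝓝 (TwinCode.capacity W)) ∧
    ∀ tie : (m : ℕ) → (TwinCode.Cube m → 𝒴) → Finset (Fin m) → ZMod 2,
      Tendsto (fun m : ℕ =>
        TwinCode.blockError W (TwinCode.goodSets W m (δ (2 ^ m))) (tie m)) atTop (𝓝 0) := by
  obtain ⟨d, hd⟩ := hpoly
  have hpow : ∀ r : ℝ, 0 < r → Tendsto (fun n : ℕ => (n : ℝ) ^ (-r)) atTop (𝓝 0) := fun r hr =>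
    (tendsto_rpow_neg_atTop hr).comp tendsto_natCast_atTop_atTop
  refine ⟨TwinCode.tendsto_rate_twinCode W hd (hsmall.trans_tendsto (hpow 2 two_pos)), ?_⟩
  refine TwinCode.tendsto_blockError W ?_
  -- `n · o(n⁻²) = o(n⁻¹)`, so the union bound `n |δ_n|` tends to `0`.
  have h := (isBigO_refl (fun n : ℕ => (n : ℝ)) atTop).mul_isLittleO hsmall
  refine (h.congr' .rfl ?_).trans_tendsto (hpow 1 one_pos)
  filter_upwards [eventually_gt_atTop 0] with n hn
  have hn' : (0 : ℝ) < n := by exact_mod_cast hn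
  nth_rewrite 1 [← Real.rpow_one (n : ℝ)]
  rw [← Real.rpow_add hn']
  norm_num
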